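/- Let $X,Y$ be real reflexive Banach spaces, let $Z_1,Z_2$ be real Banach spaces, and let $K\subset X$ and $\Lambda\subset Y$ be nonempty, bounded, closed and convex. For $\phi\colon X\to(-\infty,\infty]$ write $D(\phi)=\{x\in X:\phi(x)<\infty\}$, and for a locally Lipschitz $h\colon E\to\mathbb R$ on a Banach space $E$ let $$h^0(x;y)=\limsup_{z\to x,\ t\downarrow 0}\frac{h(z+ty)-h(z)}{t}$$ be the generalized directional derivative in the sense of Clarke. Assume that: (1) $\phi\colon X\to(-\infty,\infty]$ is proper, convex and lower semicontinuous, with $D(\phi)\cap K\neq\emptyset$; (2) $J\colon Z_1\to\mathbb R$ and $L\colon Z_2\to\mathbb R$ are locally Lipschitz; (3) $\gamma_1\colon X\to Z_1$ and $\gamma_2\colon Y\to Z_2$ are linear and compact operators; (4) $H\colon Y\to(0,m_H)$, for some $m_H>0$, is continuous with respect to the weak topology of $Y$; (5) $B\colon X\times Y\to\mathbb R$ is convex and lower semicontinuous on $X\times Y$; (6) $F\colon X\to X^*$ is such that, for each $v\in X$, $\liminf_{n\to\infty}\langle F(u_n),v-u_n\rangle\ge\langle F(u),v-u\rangle$ whenever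 $u_n\rightharpoonup u$ weakly in $X$; (7) $G\colon Y\to Y^*$ is such that, for each $\mu\in Y$, $\liminf_{n\to\infty}\langle G(\sigma_n),\mu-\sigma_n\rangle\ge\langle G(\sigma),\mu-\sigma\rangle$ whenever $\sigma_n\rightharpoonup\sigma$ weakly in $Y$. Then there exists $(u,\sigma)\in(K\cap D(\phi))\times\Lambda$ such that, for all $v\in K$ and all $\mu\in\Lambda$, $$\begin{cases} B(v,\sigma)-B(u,\sigma)+\phi(v)-\phi(u)+J^0(\gamma_1(u);\gamma_1(v-u))\ \ge\ \langle F(u),v-u\rangle,\\ B(u,\mu)-B(u,\sigma)+H(\sigma)\,L^0(\gamma_2(\sigma);\gamma_2(\mu-\sigma))\ \ge\ \langle G(\sigma),\mu-\sigma\rangle. \end{cases}$$ -/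

import Mathlib

open Filter Topology

namespace CoupledSystem

noncomputable section

/-- Reflexivity: the canonical embedding into the bidual is onto. -/
def IsReflexive (E : Type*) [NormedAddCommGroup E] [NormedSpace ℝ E] : Prop :=
  Function.Surjective (NormedSpace.inclusionInDoubleDual ℝ E)

/-- The effective domain `D(φ)` of an extended-real-valued functional. -/
def effectiveDomain {E : Type*} (φ : E → EReal) : Set E := {x | φ x < ⊤}

/-- `φ` takes values in `(-∞, ∞]` and is not identically `∞`. -/
def IsProper {E : Type*} (φ : E → EReal) : Prop :=
  (∀ x, φ x ≠ ⊥) ∧ (effectiveDomain φ).Nonempty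

/-- Convexity of a functional with values in `(-∞, ∞]`. In `EReal` one has `0 * ⊤ = 0`, so the
inequality is trivial for `t = 0` and `t = 1`. -/
def IsConvexFunctional {E : Type*} [AddCommGroup E] [Module ℝ E] (φ : E → EReal) : Prop :=
  ∀ x y : E, ∀ t : ℝ, 0 ≤ t → t ≤ 1 →
    φ (t • x + (1 - t) • y) ≤ (t : EReal) * φ x + ((1 - t : ℝ) : EReal) * φ y

/-- Clarke's generalized directional derivative
`h⁰(x; y) = limsup_{z → x, t ↓ 0} (h (z + t y) - h z) / t`.
For locally Lipschitz `h` the quotients are bounded near `(x, 0⁺)`, so the real `limsup` is the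
true one. -/
def clarkeDeriv {E : Type*} [NormedAddCommGroup E] [NormedSpace ℝ E] (h : E → ℝ) (x y : E) : ℝ :=
  limsup (fun p : E × ℝ => (h (p.1 + p.2 • y) - h p.1) / p.2) (𝓝 x ×ˢ 𝓝[>] (0 : ℝ))

/-- Weak convergence `xₙ ⇀ x` of a sequence. -/
def WeaklyConverges {E : Type*} [NormedAddCommGroup E] [NormedSpace ℝ E]
    (x : ℕ → E) (x₀ : E) : Prop :=
  Tendsto (fun n => toWeakSpace ℝ E (x n)) atTop (𝓝 (toWeakSpace ℝ E x₀))

/-- Weak continuity of a real functional: continuity for the weak topology of `E`. -/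
def IsWeaklyContinuous {E : Type*} [NormedAddCommGroup E] [NormedSpace ℝ E] (H : E → ℝ) : Prop :=
  Continuous (fun x : WeakSpace ℝ E => H ((toWeakSpace ℝ E).symm x))

/-- For every `v`, the map `u ↦ ⟨A u, v - u⟩` is weakly lower semicontinuous along sequences.
The `liminf` is taken in `[-∞, ∞]`. -/
def IsWeaklyLscPairing {E : Type*} [NormedAddCommGroup E] [NormedSpace ℝ E]
    (A : E → StrongDual ℝ E) : Prop :=
  ∀ (v : E) (u : ℕ → E) (u₀ : E), WeaklyConverges u u₀ →
    ((A u₀ (v - u₀) : ℝ) : EReal) ≤ liminf (fun n => ((A (u n) (v - u n) : ℝ) : EReal)) atTop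

/-- `(u, σ)` solves the coupled system: `u ∈ K ∩ D(φ)`, `σ ∈ Λ`, and both inequalities hold for all
`v ∈ K`, `μ ∈ Λ`. The first one is an inequality in `(-∞, ∞]`, as `φ v` may be `∞`. -/
structure IsSolution {X Y Z₁ Z₂ : Type*}
    [NormedAddCommGroup X] [NormedSpace ℝ X] [NormedAddCommGroup Y] [NormedSpace ℝ Y]
    [NormedAddCommGroup Z₁] [NormedSpace ℝ Z₁] [NormedAddCommGroup Z₂] [NormedSpace ℝ Z₂]
    (K : Set X) (Λ : Set Y) (B : X × Y → ℝ) (φ : X → EReal) (J : Z₁ → ℝ) (L : Z₂ → ℝ)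
    (H : Y → ℝ) (γ₁ : X →ₗ[ℝ] Z₁) (γ₂ : Y →ₗ[ℝ] Z₂)
    (F : X → StrongDual ℝ X) (G : Y → StrongDual ℝ Y) (u : X) (σ : Y) : Prop where
  mem_K : u ∈ K
  mem_domain : u ∈ effectiveDomain φ
  mem_Λ : σ ∈ Λ
  first : ∀ v ∈ K,
    ((B (v, σ) - B (u, σ) : ℝ) : EReal) + (φ v - φ u)
      + ((clarkeDeriv J (γ₁ u) (γ₁ (v - u)) : ℝ) : EReal) ≥ ((F u (v - u) : ℝ) : EReal)
  second : ∀ μ ∈ Λ,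
    B (u, μ) - B (u, σ) + H σ * clarkeDeriv L (γ₂ σ) (γ₂ (μ - σ)) ≥ G σ (μ - σ)

end

end CoupledSystem

/-! The two inequalities are merged into one on the product space: for z = (u, σ) and w = (v, μ),
add them, but with the joint increment B(v, μ) - B(u, σ) in place of the two partial ones. Testing
the merged inequality with w = (v, σ) kills every term of the second inequality and turns the
increment of B into the partial one; w = (u, μ) does the same for the other. So a solution of the
merged inequality solves the system (`isSolution_of_le_jointBound`).

The merged inequality reads φ(u) ≤ R(z, w), with R = `jointBound`. It is an equilibrium problem of
Ky Fan type. R is convex in w and R(z, z) = φ(u), so the sets S(w) = {z ∈ K × Λ : φ(u) ≤ R(z, w)}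
have the KKM property. They are weakly sequentially closed: φ and B are weakly lower semicontinuous,
compactness of γ₁, γ₂ makes the Clarke terms upper semicontinuous, H is positive and weakly
continuous, and F, G are controlled by hypothesis (`le_jointBound_of_weaklyConverges`). The KKM
principle `IsReflexive.exists_mem_forall_of_kkm` yields a point common to all S(w).

The hypotheses on F and G are sequential, whereas the compactness argument needs weakly closed sets.
Kaplansky's countable tightness, with metrizability of weakly compact sets in separable subspaces,
bridges this for bounded sets in a reflexive space. The finite-dimensional KKM lemma comes from
Brouwer's theorem, itself derived from Scarf's combinatorial lemma by a parity argument. -/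

namespace CoupledSystem

/-! ### Scarf's lemma: parity of dominant sets. -/

section Scarf

set_option linter.unusedSectionVars false

variable {U I : Type*} [Fintype U] [DecidableEq U] [Fintype I] [DecidableEq I]

/-- A finite set `S` is dominant for the orders on `U` given by the keys `k i` if no point of `U`
exceeds, in every one of these orders, the minimum of `S`. -/
def Dominant (k : I → U → ℕ) (S : Finset U) : Prop :=
  ∀ y : U, ∃ i, ∀ s ∈ S, k i y ≤ k i s

theorem Dominant.mono {k : I → U → ℕ} {S R : Finset U} (h : Dominant k R) (hSR : S ⊆ R) :
    Dominant k S := fun y =>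
  let ⟨i, hi⟩ := h y
  ⟨i, fun s hs => hi s (hSR hs)⟩

/-- The points that exceed the minimum of `S` in every order other than the `i`-th. -/
def exceedingExcept (k : I → U → ℕ) (S : Finset U) (i : I) : Set U :=
  {y | ∀ j, j ≠ i → ∃ s ∈ S, k j s < k j y}

/-- Adding to a dominant set `S` a maximal point of `exceedingExcept k S i` keeps it dominant. -/
theorem Dominant.insert_of_maximal {k : I → U → ℕ} {S : Finset U} (hS : Dominant k S) {i : I}
    {z : U} (hz : z ∈ exceedingExcept k S i)
    (hmax : ∀ y ∈ exceedingExcept k S i, k i y ≤ k i z) : Dominant k (insert z S) := by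
  intro y
  by_cases hy : y ∈ exceedingExcept k S i
  · obtain ⟨j, hj⟩ := hS y
    have hji : j = i := by
      by_contra hne
      obtain ⟨s, hs, hlt⟩ := hy j hne
      exact absurd (hj s hs) (not_le.2 hlt)
    subst hji
    refine ⟨j, fun s hs => ?_⟩
    rcases Finset.mem_insert.1 hs with rfl | hs
    · exact hmax y hy
    · exact hj s hs
  · simp only [exceedingExcept, Set.mem_ofPred_eq, not_forall, not_exists, not_and, not_lt] at hy
    obtain ⟨j, hji, hj⟩ := hy
    refine ⟨j, fun s hs => ?_⟩
    rcases Finset.mem_insert.1 hs with rfl | hs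
    · obtain ⟨s', hs', hlt⟩ := hz j hji
      exact (hj s' hs').trans hlt.le
    · exact hj s hs

/-- In a dominant set one element short of the number of orders, exactly one pair of orders share
their minimum; a point can be added to the set exactly if it is a maximal point of
`exceedingExcept k S i` for an order `i` of this pair. -/
theorem Dominant.exists_pair {k : I → U → ℕ} (hk : ∀ i, Function.Injective (k i)) {S : Finset U}
    (hS : Dominant k S) (hne : S.Nonempty) (hcard : S.card + 1 = Fintype.card I) :
    ∃ i₁ i₂ : I, i₁ ≠ i₂ ∧ (∃ m ∈ S, ∀ s ∈ S, k i₁ m ≤ k i₁ s ∧ k i₂ m ≤ k i₂ s) ∧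
      ∀ z, (z ∉ S ∧ Dominant k (insert z S)) ↔
        ∃ i, (i = i₁ ∨ i = i₂) ∧ z ∈ exceedingExcept k S i ∧
          ∀ y ∈ exceedingExcept k S i, k i y ≤ k i z := by
  have hmin : ∀ i, ∃ m ∈ S, ∀ s ∈ S, k i m ≤ k i s := fun i => S.exists_min_image (k i) hne
  choose m hmS hm using hmin
  have hsurj : ∀ s ∈ S, ∃ i, m i = s := by
    intro s hs
    obtain ⟨i, hi⟩ := hS s
    exact ⟨i, hk i (le_antisymm (hm i s hs) (hi _ (hmS i)))⟩
  have hex : ∃ i₁ i₂ : I, i₁ ≠ i₂ ∧ m i₁ = m i₂ := by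
    obtain ⟨i₁, -, i₂, -, hne, h⟩ := Finset.exists_ne_map_eq_of_card_lt_of_maps_to
      (s := (Finset.univ : Finset I)) (t := S) (f := m)
      (by rw [Finset.card_univ]; omega) (fun i _ => hmS i)
    exact ⟨i₁, i₂, hne, h⟩
  obtain ⟨i₁, i₂, h12, hm12⟩ := hex
  -- There is one order more than there are points, so `m` without `i₁` is a bijection onto `S` and
  -- the coincidence of `i₁` and `i₂` is the only one.
  have himg : (Finset.univ.erase i₁).image m = S := by
    ext s
    simp only [Finset.mem_image, Finset.mem_erase, Finset.mem_univ, and_true]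
    constructor
    · rintro ⟨i, -, rfl⟩; exact hmS i
    · intro hs
      obtain ⟨i, rfl⟩ := hsurj s hs
      by_cases hi : i = i₁
      · exact ⟨i₂, h12.symm, by rw [hi, hm12]⟩
      · exact ⟨i, hi, rfl⟩
  have hinj : Set.InjOn m (Finset.univ.erase i₁ : Finset I) := by
    apply Finset.injOn_of_card_image_eq
    rw [himg, Finset.card_erase_of_mem (Finset.mem_univ _), Finset.card_univ]
    omega
  refine ⟨i₁, i₂, h12, ⟨m i₁, hmS _, fun s hs => ⟨hm _ s hs, hm12 ▸ hm _ s hs⟩⟩, fun z => ⟨?_, ?_⟩⟩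
  · rintro ⟨hzS, hdom⟩
    obtain ⟨i, hi⟩ := hdom z
    have hlt : ∀ s ∈ S, k i z < k i s := fun s hs =>
      lt_of_le_of_ne (hi s (Finset.mem_insert_of_mem hs))
        fun h => hzS (hk i h ▸ hs)
    have hzM : z ∈ exceedingExcept k S i := by
      intro j hji
      by_contra hcon
      push Not at hcon
      -- then `z` is the minimum for both `i` and `j`, so `m` restricted to the others is onto `S`
      have hsub : S ⊆ ((Finset.univ.erase i).erase j).image m := by
        intro s hs
        obtain ⟨l, hl⟩ := hdom s
        have hli : l ≠ i := by
          rintro rfl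
          exact absurd (hl z (Finset.mem_insert_self _ _)) (not_le.2 (hlt s hs))
        have hlj : l ≠ j := by
          rintro rfl
          have := hk l (le_antisymm (hl z (Finset.mem_insert_self _ _)) (hcon s hs))
          exact hzS (this ▸ hs)
        refine Finset.mem_image.2 ⟨l, by simp [hli, hlj], ?_⟩
        exact hk l (le_antisymm (hm l s hs) (hl _ (Finset.mem_insert_of_mem (hmS l))))
      have h1 := (Finset.card_le_card hsub).trans Finset.card_image_le
      rw [Finset.card_erase_of_mem (by simp [hji]), Finset.card_erase_of_mem (Finset.mem_univ _),
        Finset.card_univ] at h1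
      have : 0 < S.card := hne.card_pos
      omega
    refine ⟨i, ?_, hzM, ?_⟩
    · by_contra hcon
      push Not at hcon
      obtain ⟨l, hl⟩ := hdom (m i)
      have hli : l ≠ i := by
        rintro rfl
        exact absurd (hl z (Finset.mem_insert_self _ _)) (not_le.2 (hlt _ (hmS l)))
      have hml : m l = m i :=
        hk l (le_antisymm (hm l _ (hmS i)) (hl _ (Finset.mem_insert_of_mem (hmS l))))
      by_cases hl1 : l = i₁
      · have : i₂ = i := hinj (by simp [h12.symm]) (by simp [hcon.1])
          (by rw [← hm12, ← hl1, hml])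
        exact hcon.2 this.symm
      · exact hli (hinj (by simp [hl1]) (by simp [hcon.1]) hml)
    · intro y hy
      obtain ⟨l, hl⟩ := hdom y
      have hli : l = i := by
        by_contra hne
        obtain ⟨s, hs, hlt⟩ := hy l hne
        exact absurd (hl s (Finset.mem_insert_of_mem hs)) (not_le.2 hlt)
      exact hli ▸ hl z (Finset.mem_insert_self _ _)
  · rintro ⟨i, hi, hzM, hmax⟩
    refine ⟨fun hzS => ?_, hS.insert_of_maximal hzM hmax⟩
    -- A point of `S` is the minimum for some order. Since `i₁` and `i₂` share their minimum, this
    -- order can be chosen different from `i`, and there `z` would have to exceed itself.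
    obtain ⟨l, hl⟩ := hsurj z hzS
    obtain ⟨l', hne', hl'⟩ : ∃ l', l' ≠ i ∧ m l' = z := by
      by_cases hli : l = i
      · rcases hi with rfl | rfl
        · exact ⟨i₂, h12.symm, by rw [← hm12, ← hli, hl]⟩
        · exact ⟨i₁, h12, by rw [hm12, ← hli, hl]⟩
      · exact ⟨l, hli, hl⟩
    obtain ⟨s, hs, hlt⟩ := hzM l' hne'
    exact absurd (hm l' s hs) (by rw [hl']; exact not_le.2 hlt)

/-- A common point would exceed the minimum of `S` in every order, against dominance. -/
theorem exceedingExcept_disjoint {k : I → U → ℕ} {S : Finset U} (hS : Dominant k S) {i₁ i₂ : I}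
    (h : i₁ ≠ i₂) {z : U} (h₁ : z ∈ exceedingExcept k S i₁) : z ∉ exceedingExcept k S i₂ := by
  intro h₂
  obtain ⟨l, hl⟩ := hS z
  obtain ⟨s, hs, hlt⟩ : ∃ s ∈ S, k l s < k l z := by
    by_cases hl1 : l = i₁
    · exact h₂ l (hl1 ▸ h)
    · exact h₁ l hl1
  exact absurd (hl s hs) (not_le.2 hlt)

open Classical in
/-- The points that can be added to `S` keeping it dominant. -/
noncomputable def extensions (k : I → U → ℕ) (S : Finset U) : Finset U :=
  Finset.univ.filter fun z => z ∉ S ∧ Dominant k (insert z S)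

theorem exists_unique_maximal {k : I → U → ℕ} (hk : ∀ i, Function.Injective (k i)) {S : Finset U}
    {i : I} (h : (exceedingExcept k S i).Nonempty) :
    ∃ z, ∀ w, (w ∈ exceedingExcept k S i ∧ ∀ y ∈ exceedingExcept k S i, k i y ≤ k i w) ↔ w = z := by
  obtain ⟨z, hz, hmax⟩ := Set.exists_max_image _ (k i) (Set.toFinite (exceedingExcept k S i)) h
  refine ⟨z, fun w => ⟨fun hw => hk i (le_antisymm (hmax w hw.1) (hw.2 z hz)), ?_⟩⟩
  rintro rfl
  exact ⟨hz, hmax⟩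

theorem Dominant.card_extensions_eq_two {k : I → U → ℕ} (hk : ∀ i, Function.Injective (k i))
    {S : Finset U} (hS : Dominant k S) (hne : S.Nonempty) (hcard : S.card + 1 = Fintype.card I)
    (h : ∀ i, (exceedingExcept k S i).Nonempty) : (extensions k S).card = 2 := by
  obtain ⟨i₁, i₂, h12, -, hiff⟩ := hS.exists_pair hk hne hcard
  obtain ⟨z₁, hz₁⟩ := exists_unique_maximal hk (h i₁)
  obtain ⟨z₂, hz₂⟩ := exists_unique_maximal hk (h i₂)
  have hz : z₁ ≠ z₂ := by
    rintro rfl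
    exact exceedingExcept_disjoint hS h12 ((hz₁ _).2 rfl).1 ((hz₂ _).2 rfl).1
  rw [Finset.card_eq_two]
  refine ⟨z₁, z₂, hz, ?_⟩
  ext w
  simp only [extensions, Finset.mem_filter, Finset.mem_univ, true_and, hiff, Finset.mem_insert,
    Finset.mem_singleton, or_and_right, exists_or, exists_eq_left]
  rw [hz₁, hz₂]

/-- The boundary case of the parity count: `i₀` belongs to the pair sharing a minimum, and the other
order of the pair contributes no extension. -/
theorem Dominant.card_extensions_eq_one {k : I → U → ℕ} (hk : ∀ i, Function.Injective (k i))
    {S : Finset U} (hS : Dominant k S) (hne : S.Nonempty) (hcard : S.card + 1 = Fintype.card I)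
    (i₀ : I) (h₀ : (exceedingExcept k S i₀).Nonempty)
    (h : ∀ i m, i ≠ i₀ → m ∈ S → (∀ s ∈ S, k i m ≤ k i s ∧ k i₀ m ≤ k i₀ s) →
      exceedingExcept k S i = ∅)
    (hpair : ∀ i j m, i ≠ j → m ∈ S → (∀ s ∈ S, k i m ≤ k i s ∧ k j m ≤ k j s) →
      i = i₀ ∨ j = i₀) : (extensions k S).card = 1 := by
  obtain ⟨i₁, i₂, h12, ⟨m, hm, hmin⟩, hiff⟩ := hS.exists_pair hk hne hcard
  obtain ⟨z₀, hz₀⟩ := exists_unique_maximal hk h₀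
  rw [Finset.card_eq_one]
  refine ⟨z₀, ?_⟩
  ext w
  simp only [extensions, Finset.mem_filter, Finset.mem_univ, true_and, hiff, Finset.mem_singleton]
  rw [← hz₀ w]
  constructor
  · rintro ⟨i, hi, hw⟩
    have hi : i = i₀ := by
      by_contra hne
      suffices h' : ∀ s ∈ S, k i m ≤ k i s ∧ k i₀ m ≤ k i₀ s by
        rw [h i m hne hm h'] at hw
        exact hw.1
      rcases hpair i₁ i₂ m h12 hm hmin with rfl | rfl <;> rcases hi with rfl | rfl
      · exact absurd rfl hne
      · exact fun s hs => (hmin s hs).symm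
      · exact hmin
      · exact absurd rfl hne
    exact hi ▸ hw
  · intro hw
    exact ⟨i₀, (hpair i₁ i₂ m h12 hm hmin).imp Eq.symm Eq.symm, hw⟩

/-- A set with as many elements as there are colours, not all of which it carries, has an even
number of facets carrying exactly the colours other than `i₀`. -/
theorem even_card_facets (c : U → I) (i₀ : I) {R : Finset U} (hR : R.card = Fintype.card I)
    (hc : R.image c ≠ Finset.univ) :
    Even (R.filter fun z => (R.erase z).image c = Finset.univ.erase i₀).card := by
  rcases Finset.eq_empty_or_nonempty
    (R.filter fun z => (R.erase z).image c = Finset.univ.erase i₀) with he | ⟨z, hz⟩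
  · simp [he]
  rw [Finset.mem_filter] at hz
  obtain ⟨hzR, hz⟩ := hz
  have hcz : c z ≠ i₀ := by
    intro h
    apply hc
    rw [← Finset.insert_erase hzR, Finset.image_insert, hz, h, Finset.insert_erase (Finset.mem_univ _)]
  -- `R` without `z` is injectively coloured, so `z'` is the only other point with the colour of
  -- `z`. Only the removal of `z` or `z'` keeps all colours but `i₀`.
  obtain ⟨z', hz', hzz'⟩ : ∃ z' ∈ R.erase z, c z' = c z := by
    rw [← Finset.mem_image, hz]; simp [hcz]
  have hinj : Set.InjOn c (R.erase z : Finset U) := by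
    apply Finset.injOn_of_card_image_eq
    rw [hz, Finset.card_erase_of_mem hzR, Finset.card_erase_of_mem (Finset.mem_univ _), hR,
      Finset.card_univ]
  have hne : z ≠ z' := (Finset.ne_of_mem_erase hz').symm
  have hz'R := Finset.mem_of_mem_erase hz'
  have : (R.filter fun z => (R.erase z).image c = Finset.univ.erase i₀) = {z, z'} := by
    ext w
    simp only [Finset.mem_filter, Finset.mem_insert, Finset.mem_singleton]
    constructor
    · rintro ⟨hwR, hw⟩
      by_contra hcon
      push Not at hcon
      have hwi : c w ≠ i₀ := by
        have : c w ∈ (R.erase z).image c :=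
          Finset.mem_image_of_mem c (Finset.mem_erase.2 ⟨hcon.1, hwR⟩)
        rw [hz] at this
        exact Finset.ne_of_mem_erase this
      obtain ⟨x, hx, hxw⟩ : ∃ x ∈ R.erase w, c x = c w := by
        rw [← Finset.mem_image, hw]; simp [hwi]
      have hwz : w ∈ R.erase z := Finset.mem_erase.2 ⟨hcon.1, hwR⟩
      by_cases hxz : x = z
      · exact hcon.2 (hinj hwz hz' (by rw [hzz', ← hxz, hxw]))
      · exact Finset.ne_of_mem_erase hx
          (hinj (Finset.mem_erase.2 ⟨hxz, Finset.mem_of_mem_erase hx⟩) hwz hxw)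
    · rintro (rfl | rfl)
      · exact ⟨hzR, hz⟩
      · refine ⟨hz'R, ?_⟩
        rw [← hz]
        ext i
        simp only [Finset.mem_image, Finset.mem_erase]
        constructor
        · rintro ⟨x, ⟨hx, hxR⟩, rfl⟩
          by_cases hxz : x = z
          · exact ⟨w, ⟨hne.symm, hz'R⟩, by rw [hzz', hxz]⟩
          · exact ⟨x, ⟨hxz, hxR⟩, rfl⟩
        · rintro ⟨x, ⟨hx, hxR⟩, rfl⟩
          by_cases hxz : x = w
          · exact ⟨z, ⟨hne, hzR⟩, by rw [← hzz', hxz]⟩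
          · exact ⟨x, ⟨hxz, hxR⟩, rfl⟩
  rw [this, Finset.card_pair hne]
  exact even_two

open Classical in
/-- If exactly one dominant set carrying the colours other than `i₀` has a single extension and all
others have two, then some dominant set carries all colours. -/
theorem exists_dominant_image_eq_univ (k : I → U → ℕ) (c : U → I) (i₀ : I) (S₀ : Finset U)
    (hS₀ : Dominant k S₀) (hS₀c : S₀.card + 1 = Fintype.card I)
    (hS₀i : S₀.image c = Finset.univ.erase i₀) (h₁ : (extensions k S₀).card = 1)
    (h₂ : ∀ S, S ≠ S₀ → Dominant k S → S.card + 1 = Fintype.card I →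
      S.image c = Finset.univ.erase i₀ → (extensions k S).card = 2) :
    ∃ R : Finset U, Dominant k R ∧ R.card = Fintype.card I ∧ R.image c = Finset.univ := by
  by_contra hcon
  push Not at hcon
  -- Double counting of pairs (room, door of that room), a door being encoded by the point whose
  -- removal produces it. Without a fully coloured room each room has an even number of doors; yet
  -- every door has two rooms except `S₀`, which has one.
  let P : Finset (Finset U × U) := Finset.univ.filter fun p =>
    Dominant k p.1 ∧ p.1.card = Fintype.card I ∧ p.2 ∈ p.1 ∧
      (p.1.erase p.2).image c = Finset.univ.erase i₀
  let rooms : Finset (Finset U) := Finset.univ.filter fun R =>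
    Dominant k R ∧ R.card = Fintype.card I
  let doors : Finset (Finset U) := Finset.univ.filter fun S =>
    Dominant k S ∧ S.card + 1 = Fintype.card I ∧ S.image c = Finset.univ.erase i₀
  have heven : Even P.card := by
    rw [Finset.card_eq_sum_card_fiberwise (f := Prod.fst) (t := rooms)]
    · refine Finset.even_sum _ fun R hR => ?_
      simp only [rooms, Finset.mem_filter, Finset.mem_univ, true_and] at hR
      have : P.filter (fun p => p.1 = R) =
          (R.filter fun z => (R.erase z).image c = Finset.univ.erase i₀).map
            ⟨fun z => (R, z), fun a b h => (Prod.ext_iff.1 h).2⟩ := by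
        ext ⟨R', z⟩
        simp only [P, Finset.mem_filter, Finset.mem_univ, true_and, Finset.mem_map]
        constructor
        · rintro ⟨⟨-, -, hz, hzc⟩, rfl⟩
          exact ⟨z, ⟨hz, hzc⟩, rfl⟩
        · rintro ⟨z', ⟨hz, hzc⟩, heq⟩
          cases heq
          exact ⟨⟨hR.1, hR.2, hz, hzc⟩, rfl⟩
      rw [this, Finset.card_map]
      exact even_card_facets c i₀ hR.2 (hcon R hR.1 hR.2)
    · intro p hp
      simp only [P, Finset.coe_filter, Finset.mem_univ, true_and, Set.mem_ofPred_eq] at hp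
      simp [rooms, hp.1, hp.2.1]
  have hodd : Odd P.card := by
    have hS₀d : S₀ ∈ doors := by simp [doors, hS₀, hS₀c, hS₀i]
    rw [Finset.card_eq_sum_card_fiberwise (f := fun p => p.1.erase p.2) (t := doors)]
    · have hfib : ∀ S ∈ doors, (P.filter fun p => p.1.erase p.2 = S).card =
          (extensions k S).card := by
        intro S hS
        simp only [doors, Finset.mem_filter, Finset.mem_univ, true_and] at hS
        have : (P.filter fun p => p.1.erase p.2 = S) = (extensions k S).map
            ⟨fun z => (insert z S, z), fun a b h => (Prod.ext_iff.1 h).2⟩ := by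
          ext ⟨R, z⟩
          simp only [P, extensions, Finset.mem_filter, Finset.mem_univ, true_and, Finset.mem_map]
          constructor
          · rintro ⟨⟨hR, -, hz, -⟩, rfl⟩
            exact ⟨z, ⟨Finset.notMem_erase z R, by rwa [Finset.insert_erase hz]⟩,
              Prod.ext (Finset.insert_erase hz) rfl⟩
          · rintro ⟨z', ⟨hz, hd⟩, heq⟩
            cases heq
            have he := Finset.erase_insert hz
            refine ⟨⟨hd, ?_, Finset.mem_insert_self _ _, ?_⟩, he⟩
            · rw [Finset.card_insert_of_notMem hz, hS.2.1]
            · rw [he, hS.2.2]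
        rw [this, Finset.card_map]
      rw [Finset.sum_congr rfl hfib, ← Finset.add_sum_erase _ _ hS₀d, h₁]
      refine Odd.add_even odd_one (Finset.even_sum _ fun S hS => ?_)
      obtain ⟨hne, hS⟩ := Finset.mem_erase.1 hS
      simp only [doors, Finset.mem_filter, Finset.mem_univ, true_and] at hS
      rw [h₂ S hne hS.1 hS.2.1 hS.2.2]
      exact even_two
    · intro p hp
      simp only [P, Finset.coe_filter, Finset.mem_univ, true_and, Set.mem_ofPred_eq] at hp
      simp only [doors, Finset.coe_filter, Finset.mem_univ, true_and, Set.mem_ofPred_eq]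
      refine ⟨hp.1.mono (Finset.erase_subset _ _), ?_, hp.2.2.2⟩
      rw [Finset.card_erase_of_mem hp.2.2.1, ← hp.2.1]
      exact Nat.sub_add_cancel (Finset.card_pos.2 ⟨_, hp.2.2.1⟩)
  exact (Nat.not_even_iff_odd.2 hodd) heven


/-! ### Slack points and the coloured form of Scarf's lemma. -/

variable {T : Type*} [Fintype T] [DecidableEq T]

/-- Extension of the keys on `T` to `T ⊕ I`, where the slack point `inr i` is lowest for the order
`i` and above `T` for all others. -/
noncomputable def slackKey (k : I → T → ℕ) (N : ℕ) (i : I) : T ⊕ I → ℕ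
  | .inl x => k i x + 1
  | .inr j => if j = i then 0 else N + 1 + Fintype.equivFin I j

theorem slackKey_injective {k : I → T → ℕ} {N : ℕ} (hN : ∀ i x, k i x < N)
    (hk : ∀ i, Function.Injective (k i)) (i : I) : Function.Injective (slackKey k N i) := by
  rintro (x | j) (y | l) h
  · simp only [slackKey, Nat.add_right_cancel_iff] at h
    rw [hk i h]
  · have := hN i x
    simp only [slackKey] at h
    split_ifs at h; omega
  · have := hN i y
    simp only [slackKey] at h
    split_ifs at h; omega
  · simp only [slackKey] at h
    split_ifs at h with h1 h2 h2
    · rw [h1, h2]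
    · omega
    · omega
    · have h' : Fintype.equivFin I j = Fintype.equivFin I l := Fin.ext (by omega)
      rw [(Fintype.equivFin I).injective h']

theorem slackKey_inl_lt_inr {k : I → T → ℕ} {N : ℕ} (hN : ∀ i x, k i x < N) {i j : I} (h : j ≠ i)
    (x : T) : slackKey k N i (.inl x) < slackKey k N i (.inr j) := by
  have := hN i x
  simp only [slackKey, if_neg h]
  omega

theorem slackKey_self (k : I → T → ℕ) (N : ℕ) (i : I) : slackKey k N i (.inr i) = 0 := by
  simp [slackKey]

theorem slackKey_eq_zero_iff {k : I → T → ℕ} {N : ℕ} {i : I} {z : T ⊕ I} :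
    slackKey k N i z = 0 ↔ z = .inr i := by
  rcases z with x | j <;> simp [slackKey]

/-- **Scarf's lemma**, for a finite set with finitely many linear orders and a colouring by the
orders. -/
theorem exists_dominant_colored [Nonempty T] [Nontrivial I] (k : I → T → ℕ)
    (hk : ∀ i, Function.Injective (k i)) (c : T → I) :
    ∃ (C : Finset I) (s : I → T), (∀ i ∈ C, c (s i) = i) ∧
      ∀ y, ∃ i ∈ C, ∀ j ∈ C, k i y ≤ k i (s j) := by
  obtain ⟨i₀⟩ : Nonempty I := inferInstance
  obtain ⟨x₀⟩ : Nonempty T := inferInstance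
  obtain ⟨N, hN⟩ : ∃ N, ∀ i x, k i x < N := by
    refine ⟨(Finset.univ.sup fun p : I × T => k p.1 p.2) + 1, fun i x => Nat.lt_succ_of_le ?_⟩
    exact Finset.le_sup (f := fun p : I × T => k p.1 p.2) (Finset.mem_univ (i, x))
  have hK := slackKey_injective hN hk
  have hD : ∀ (S : Finset (T ⊕ I)), (∀ x : T, ∃ i, ∀ s ∈ S,
      slackKey k N i (.inl x) ≤ slackKey k N i s) → Dominant (slackKey k N) S := by
    rintro S h (x | j)
    · exact h x
    · exact ⟨j, fun s _ => by rw [slackKey_self]; exact Nat.zero_le _⟩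
  let S₀ : Finset (T ⊕ I) := (Finset.univ.erase i₀).map Function.Embedding.inr
  have hmem : ∀ z, z ∈ S₀ ↔ ∃ j, j ≠ i₀ ∧ Sum.inr j = z := by simp [S₀]
  have hS₀ : Dominant (slackKey k N) S₀ := by
    refine hD _ fun x => ⟨i₀, fun s hs => ?_⟩
    obtain ⟨j, hj, rfl⟩ := (hmem s).1 hs
    exact (slackKey_inl_lt_inr hN hj x).le
  have hS₀c : S₀.card + 1 = Fintype.card I := by
    rw [Finset.card_map, Finset.card_erase_of_mem (Finset.mem_univ _), Finset.card_univ]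
    exact Nat.sub_add_cancel Fintype.card_pos
  have hmin : ∀ i m, i ≠ i₀ → (∀ s ∈ S₀, slackKey k N i m ≤ slackKey k N i s) → m = .inr i := by
    intro i m hi hm
    have := hm (.inr i) ((hmem _).2 ⟨i, hi, rfl⟩)
    rwa [slackKey_self, Nat.le_zero, slackKey_eq_zero_iff] at this
  have h₁ : (extensions (slackKey k N) S₀).card = 1 := by
    refine hS₀.card_extensions_eq_one hK ?_ hS₀c i₀ ⟨.inl x₀, fun j hj => ?_⟩ ?_ ?_
    · obtain ⟨j, hj⟩ := exists_ne i₀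
      exact ⟨_, (hmem _).2 ⟨j, hj, rfl⟩⟩
    · exact ⟨.inr j, (hmem _).2 ⟨j, hj, rfl⟩, by rw [slackKey_self]; simp [slackKey]⟩
    -- Here `inr i` is the minimum of `S₀` for both `i` and `i₀`. To exceed it in the order `i₀` a
    -- point must be a slack point `inr j` with `j ≠ i`, but that one is lowest in the order `j`.
    · intro i m hi hm hmm
      obtain rfl := hmin i m hi fun s hs => (hmm s hs).1
      refine Set.eq_empty_of_forall_notMem fun y hy => ?_
      obtain ⟨s, hs, hlt⟩ := hy i₀ hi.symm
      have hlt' := (hmm s hs).2.trans_lt hlt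
      rcases y with x | j
      · exact absurd hlt' (not_lt.2 (slackKey_inl_lt_inr hN hi x).le)
      · by_cases hji : j = i
        · exact absurd hlt' (by rw [hji]; exact lt_irrefl _)
        · obtain ⟨s', -, h'⟩ := hy j hji
          rw [slackKey_self] at h'
          exact absurd h' (Nat.not_lt_zero _)
    · intro i j m hij _ hmm
      by_contra hcon
      push Not at hcon
      have h1 := hmin i m hcon.1 fun s hs => (hmm s hs).1
      have h2 := hmin j m hcon.2 fun s hs => (hmm s hs).2
      rw [h1] at h2
      exact hij (Sum.inr_injective h2)
  obtain ⟨R, hR, -, hRc⟩ := exists_dominant_image_eq_univ (slackKey k N) (Sum.elim c id) i₀ S₀ hS₀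
    hS₀c (by ext i; simp [S₀]) h₁ (by
      intro S hne hS hSc hSi
      -- The only door made of slack points alone is `S₀`. Any other contains a point of `T`, which
      -- `inr i` exceeds in every order but `i`, so no `exceedingExcept` is empty.
      have hx : ∃ x, Sum.inl x ∈ S := by
        by_contra hcon
        push Not at hcon
        refine hne (Finset.ext fun z => ?_)
        rw [hmem]
        constructor
        · intro hz
          rcases z with x | j
          · exact absurd hz (hcon x)
          · refine ⟨j, ?_, rfl⟩
            have : j ∈ S.image (Sum.elim c id) := Finset.mem_image.2 ⟨_, hz, rfl⟩
            rw [hSi] at this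
            exact Finset.ne_of_mem_erase this
        · rintro ⟨j, hj, rfl⟩
          have : j ∈ S.image (Sum.elim c id) := by rw [hSi]; simp [hj]
          obtain ⟨z, hz, hzj⟩ := Finset.mem_image.1 this
          rcases z with x | l
          · exact absurd hz (hcon x)
          · rwa [← (show l = j from hzj)]
      obtain ⟨x, hx⟩ := hx
      refine hS.card_extensions_eq_two hK ⟨_, hx⟩ hSc fun i => ⟨.inr i, fun j hj => ?_⟩
      exact ⟨_, hx, slackKey_inl_lt_inr hN hj.symm x⟩)
  have hs : ∀ i, ∃ x, Sum.inr i ∉ R → Sum.inl x ∈ R ∧ c x = i := by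
    intro i
    by_cases hi : Sum.inr i ∈ R
    · exact ⟨x₀, fun h => absurd hi h⟩
    · obtain ⟨z, hz, hzi⟩ := Finset.mem_image.1 (hRc ▸ Finset.mem_univ i : i ∈ R.image _)
      rcases z with x | l
      · exact ⟨x, fun _ => ⟨hz, hzi⟩⟩
      · exact absurd (show l = i from hzi) (fun h => hi (h ▸ hz))
  choose s hs using hs
  -- `C` collects the colours not supplied by their slack point. If `inr i ∈ R`, its key 0 lies
  -- below that of every point of `T`, so the order `i` cannot witness dominance over `y`.
  refine ⟨Finset.univ.filter fun i => Sum.inr i ∉ R, s, fun i hi => ?_, fun y => ?_⟩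
  · exact (hs i (by simpa using hi)).2
  · obtain ⟨i, hi⟩ := hR (.inl y)
    refine ⟨i, ?_, fun j hj => ?_⟩
    · simp only [Finset.mem_filter, Finset.mem_univ, true_and]
      intro h
      have := hi _ h
      rw [slackKey_self] at this
      simp [slackKey] at this
    · have := hi _ (hs j (by simpa using hj)).1
      simpa [slackKey] using this

/-- Scarf's lemma for the integer points of a dilated simplex: there are points of the colours
`i ∈ C` that are close to each other and to the face spanned by `C`. -/
theorem exists_close_colored_points [Nontrivial I] (l : ℕ) (c : (I → ℕ) → I) :
    ∃ (C : Finset I) (s : I → I → ℕ), C.Nonempty ∧ (∀ i ∈ C, c (s i) = i) ∧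
      (∀ i ∈ C, ∑ a, s i a = l) ∧
      (∀ i ∈ C, ∀ j ∈ C, ∀ a ∈ C, s i a < s j a + Fintype.card I) ∧
      ∀ i ∈ C, ∀ a ∉ C, s i a < Fintype.card I := by
  let P : Finset (I → ℕ) := Finset.piAntidiag Finset.univ l
  have hP : ∀ x, x ∈ P ↔ ∑ a, x a = l := fun x => by simp [P]
  let N := Fintype.card P
  -- Order by the `i`-th coordinate, with ties broken by an enumeration of `P`.
  let k : I → P → ℕ := fun i x => x.1 i * N + Fintype.equivFin P x
  have hkle : ∀ i x y, k i x ≤ k i y → x.1 i ≤ y.1 i := by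
    intro i x y h
    by_contra hlt
    push Not at hlt
    have h1 : (y.1 i + 1) * N ≤ x.1 i * N := Nat.mul_le_mul_right _ hlt
    have h2 := (Fintype.equivFin P y).2
    simp only [k] at h
    rw [Nat.add_mul] at h1
    omega
  have hk : ∀ i, Function.Injective (k i) := by
    intro i x y h
    have h1 := le_antisymm (hkle i x y h.le) (hkle i y x h.ge)
    simp only [k, h1, Nat.add_left_cancel_iff] at h
    exact (Fintype.equivFin P).injective (Fin.ext h)
  obtain ⟨i₀⟩ : Nonempty I := inferInstance
  have hsingle : ∀ (C : Finset I) (m : I → ℕ), C.Nonempty → ∑ i ∈ C, m i ≤ l →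
      ∃ y : P, ∀ i ∈ C, m i ≤ y.1 i := by
    rintro C m ⟨j, hj⟩ hm
    refine ⟨⟨fun a => (if a ∈ C then m a else 0) + if a = j then l - ∑ i ∈ C, m i else 0, ?_⟩, ?_⟩
    · rw [hP, Finset.sum_add_distrib]
      simp
      omega
    · intro i hi
      simp [hi]
  have : Nonempty P := let ⟨y, _⟩ := hsingle {i₀} 0 ⟨i₀, by simp⟩ (by simp); ⟨y⟩
  obtain ⟨C, s, hsc, hdom⟩ := exists_dominant_colored k hk fun x => c x.1
  have hC : C.Nonempty := let ⟨i, hi, _⟩ := hdom (Classical.arbitrary P); ⟨i, hi⟩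
  have hmin : ∀ a, ∃ j ∈ C, ∀ i ∈ C, (s j).1 a ≤ (s i).1 a :=
    fun a => C.exists_min_image (fun i => (s i).1 a) hC
  choose b hbC hb using hmin
  -- Otherwise some point of the simplex would exceed all the coordinate minima over `C`, against
  -- dominance. Hence these minima add up to more than `l - C.card`; as each `s i` has total `l`,
  -- its excess over them, together with its coordinates outside `C`, is less than `C.card`.
  have hsum : l < ∑ a ∈ C, ((s (b a)).1 a + 1) := by
    by_contra hcon
    obtain ⟨y, hy⟩ := hsingle C (fun a => (s (b a)).1 a + 1) hC (not_lt.1 hcon)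
    obtain ⟨i, hi, h⟩ := hdom y
    have h1 := hkle _ _ _ (h (b i) (hbC i))
    have h2 := hy i hi
    omega
  rw [Finset.sum_add_distrib, Finset.sum_const, smul_eq_mul, mul_one] at hsum
  have hCc : C.card ≤ Fintype.card I := Finset.card_le_univ C
  have hsl : ∀ i, ∑ a, (s i).1 a = l := fun i => (hP _).1 (s i).2
  refine ⟨C, fun i => (s i).1, hC, hsc, fun i _ => hsl i, fun i hi j hj a ha => ?_,
    fun i hi a ha => ?_⟩
  · have h1 : ∑ a ∈ C, (s i).1 a ≤ l := by
      rw [← hsl i]; exact Finset.sum_le_sum_of_subset (Finset.subset_univ _)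
    have h2 : ∑ a ∈ C.erase a, (s (b a)).1 a ≤ ∑ a ∈ C.erase a, (s i).1 a :=
      Finset.sum_le_sum fun a _ => hb a i hi
    rw [← Finset.add_sum_erase C _ ha] at h1 hsum
    have h3 := hb a j hj
    dsimp only
    omega
  · have h1 : ∑ a ∈ insert a C, (s i).1 a ≤ l := by
      rw [← hsl i]; exact Finset.sum_le_sum_of_subset (Finset.subset_univ _)
    have h2 : ∑ a ∈ C, (s (b a)).1 a ≤ ∑ a ∈ C, (s i).1 a :=
      Finset.sum_le_sum fun a _ => hb a i hi
    rw [Finset.sum_insert ha] at h1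
    dsimp only
    omega

end Scarf

/-! ### Brouwer's theorem and the KKM lemma on the simplex. -/

section Simplex

variable {I : Type*} [Fintype I]

/-- **Brouwer's fixed point theorem**, up to `ε`, on the standard simplex. -/
theorem exists_le_add_of_mapsTo_stdSimplex [Nontrivial I] {f : (I → ℝ) → I → ℝ}
    (hf : ContinuousOn f (stdSimplex ℝ I)) (hmaps : Set.MapsTo f (stdSimplex ℝ I) (stdSimplex ℝ I))
    {ε : ℝ} (hε : 0 < ε) : ∃ x ∈ stdSimplex ℝ I, ∀ a, x a ≤ f x a + ε := by
  classical
  have huc := (isCompact_stdSimplex ℝ I).uniformContinuousOn_of_continuous hf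
  rw [Metric.uniformContinuousOn_iff] at huc
  obtain ⟨δ, hδ, hδf⟩ := huc (ε / 2) (half_pos hε)
  let n : ℝ := Fintype.card I
  -- The points from Scarf's lemma are within `n / l` of each other. This must be less than `δ` for
  -- uniform continuity, and at most half of the allowed error.
  obtain ⟨l, hl⟩ := exists_nat_gt (n / min δ (ε / 2))
  have hmin : 0 < min δ (ε / 2) := lt_min hδ (half_pos hε)
  have hn : 0 < n := Nat.cast_pos.2 Fintype.card_pos
  have hl0 : (0 : ℝ) < l := (div_pos hn hmin).trans hl
  have hnl : n / l < min δ (ε / 2) := by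
    rw [div_lt_iff₀ hmin] at hl
    rw [div_lt_iff₀ hl0]; linarith
  let p : (I → ℕ) → I → ℝ := fun x a => x a / l
  have hp : ∀ x : I → ℕ, ∑ a, x a = l → p x ∈ stdSimplex ℝ I := by
    intro x hx
    refine ⟨fun a => by positivity, ?_⟩
    rw [← Finset.sum_div, ← Nat.cast_sum, hx, div_self hl0.ne']
  -- The colour of a point is a coordinate that `f` does not decrease; one exists because both
  -- points have coordinate sum 1.
  have hc : ∀ x : I → ℕ, ∃ i, ∑ a, x a = l → p x i ≤ f (p x) i := by
    intro x
    by_contra hcon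
    push Not at hcon
    have hx : ∑ a, x a = l := (hcon (Classical.arbitrary I)).1
    have : ∑ i, f (p x) i < ∑ i, p x i :=
      Finset.sum_lt_sum_of_nonempty Finset.univ_nonempty fun i _ => (hcon i).2
    rw [(hmaps (hp x hx)).2, (hp x hx).2] at this
    exact lt_irrefl _ this
  choose c hc using hc
  obtain ⟨C, s, ⟨j, hj⟩, hsc, hsl, hclose, hface⟩ := exists_close_colored_points l c
  have hclose' : ∀ i ∈ C, ∀ j ∈ C, ∀ a ∈ C, p (s i) a < p (s j) a + n / l := by
    intro i hi j hj a ha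
    simp only [p]
    rw [← add_div]
    exact div_lt_div_of_pos_right (by simp only [n]; exact_mod_cast hclose i hi j hj a ha) hl0
  have hface' : ∀ i ∈ C, ∀ a ∉ C, p (s i) a < n / l := by
    intro i hi a ha
    exact div_lt_div_of_pos_right (by simp only [n]; exact_mod_cast hface i hi a ha) hl0
  refine ⟨p (s j), hp _ (hsl j hj), fun a => ?_⟩
  by_cases ha : a ∈ C
  · have hdist : dist (p (s a)) (p (s j)) < δ := by
      rw [dist_pi_lt_iff hδ]
      intro b
      rw [Real.dist_eq, abs_lt]
      have h1 := (hp _ (hsl j hj)).1 b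
      have h2 := (hp _ (hsl a ha)).1 b
      have h3 := hnl.trans_le (min_le_left _ _)
      by_cases hb : b ∈ C
      · have h4 := hclose' a ha j hj b hb
        have h5 := hclose' j hj a ha b hb
        constructor <;> linarith
      · have h4 := hface' a ha b hb
        have h5 := hface' j hj b hb
        constructor <;> linarith
    have h1 := hδf _ (hp _ (hsl a ha)) _ (hp _ (hsl j hj)) hdist
    have h2 := (dist_pi_lt_iff (half_pos hε)).1 h1 a
    rw [Real.dist_eq, abs_lt] at h2
    have h3 := hc (s a) (hsl a ha)
    rw [hsc a ha] at h3
    have h4 := hclose' j hj a ha a ha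
    have h5 := hnl.trans_le (min_le_right _ _)
    linarith
  · have h1 := hface' j hj a ha
    have h2 := (hmaps (hp _ (hsl j hj))).1 a
    have h5 := hnl.trans_le (min_le_right _ _)
    linarith

/-- **Brouwer's fixed point theorem** on the standard simplex. -/
theorem exists_fixedPoint_stdSimplex [Nonempty I] {f : (I → ℝ) → I → ℝ}
    (hf : ContinuousOn f (stdSimplex ℝ I))
    (hmaps : Set.MapsTo f (stdSimplex ℝ I) (stdSimplex ℝ I)) :
    ∃ x ∈ stdSimplex ℝ I, f x = x := by
  classical
  obtain ⟨i₀⟩ : Nonempty I := inferInstance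
  have hne : (stdSimplex ℝ I).Nonempty := ⟨_, single_mem_stdSimplex ℝ i₀⟩
  suffices h : ∃ x ∈ stdSimplex ℝ I, ∀ a, x a ≤ f x a by
    obtain ⟨x, hx, hle⟩ := h
    refine ⟨x, hx, funext fun a => ?_⟩
    have := (Finset.sum_eq_sum_iff_of_le fun a _ => hle a).1
      ((hx.2).trans (hmaps hx).2.symm)
    exact (this a (Finset.mem_univ a)).symm
  rcases subsingleton_or_nontrivial I with hI | hI
  · obtain ⟨x, hx⟩ := hne
    refine ⟨x, hx, fun a => le_of_eq ?_⟩
    have h1 := hx.2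
    have h2 := (hmaps hx).2
    rw [Fintype.sum_subsingleton _ a] at h1 h2
    rw [h1, h2]
  -- The total violation of `x ≤ f x` attains its minimum, which is 0 by the approximate theorem.
  have hg : ContinuousOn (fun x => ∑ a, max (x a - f x a) 0) (stdSimplex ℝ I) := by
    refine continuousOn_finsetSum _ fun a _ => ContinuousOn.sup (ContinuousOn.sub ?_ ?_)
      continuousOn_const
    · exact (continuous_apply a).continuousOn
    · exact (continuous_apply a).comp_continuousOn hf
  obtain ⟨x, hx, hmin⟩ := (isCompact_stdSimplex ℝ I).exists_isMinOn hne hg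
  refine ⟨x, hx, fun a => ?_⟩
  have h0 : ∑ a, max (x a - f x a) 0 ≤ 0 := by
    refine le_of_forall_pos_le_add fun ε hε => ?_
    have hn : (0 : ℝ) < Fintype.card I := Nat.cast_pos.2 Fintype.card_pos
    obtain ⟨y, hy, hyε⟩ := exists_le_add_of_mapsTo_stdSimplex hf hmaps (div_pos hε hn)
    refine (hmin hy).trans ?_
    refine (Finset.sum_le_card_nsmul _ _ (ε / Fintype.card I) fun a _ => ?_).trans ?_
    · exact max_le (by linarith [hyε a]) (div_pos hε hn).le
    · rw [nsmul_eq_mul, Finset.card_univ, mul_div_cancel₀ _ hn.ne', zero_add]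
  have h1 := (Finset.sum_eq_zero_iff_of_nonneg fun a _ => le_max_right (x a - f x a) 0).1
    (le_antisymm h0 (Finset.sum_nonneg fun a _ => le_max_right _ _)) a (Finset.mem_univ a)
  have h2 := le_max_left (x a - f x a) 0
  linarith

/-- The **Knaster–Kuratowski–Mazurkiewicz lemma**. -/
theorem exists_mem_forall_of_cover_stdSimplex [Nonempty I] {A : I → Set (I → ℝ)}
    (hA : ∀ i, IsClosed (A i)) (hcov : ∀ x ∈ stdSimplex ℝ I, ∃ i, 0 < x i ∧ x ∈ A i) :
    ∃ x ∈ stdSimplex ℝ I, ∀ i, x ∈ A i := by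
  classical
  -- The vertex `i` can only be covered by `A i`. Nonemptiness matters because `Metric.infDist` to
  -- the empty set is 0.
  have hne : ∀ i, (A i).Nonempty := by
    intro i
    obtain ⟨j, hj, hjA⟩ := hcov _ (single_mem_stdSimplex ℝ i)
    have : j = i := by
      by_contra h
      simp [h] at hj
    exact ⟨_, this ▸ hjA⟩
  let d : I → (I → ℝ) → ℝ := fun i x => Metric.infDist x (A i)
  have hd0 : ∀ i x, 0 ≤ d i x := fun i x => Metric.infDist_nonneg
  have hD : ∀ x, 0 < 1 + ∑ i, d i x := fun x =>
    add_pos_of_pos_of_nonneg one_pos (Finset.sum_nonneg fun i _ => hd0 i x)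
  have hdc : ∀ i, Continuous (d i) := fun i => Metric.continuous_infDist_pt _
  -- At a fixed point `d i x = x i * ∑ j, d j x`. An index with `0 < x i` and `x ∈ A i` makes the
  -- sum vanish, and with it all distances.
  let f : (I → ℝ) → I → ℝ := fun x i => (x i + d i x) / (1 + ∑ j, d j x)
  have hf : Continuous f := continuous_pi fun i =>
    ((continuous_apply i).add (hdc i)).div
      (continuous_const.add (continuous_finsetSum _ fun j _ => hdc j)) fun x => (hD x).ne'
  obtain ⟨x, hx, hfx⟩ := exists_fixedPoint_stdSimplex hf.continuousOn (fun x hx => by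
    refine ⟨fun i => div_nonneg (add_nonneg (hx.1 i) (hd0 i x)) (hD x).le, ?_⟩
    rw [← Finset.sum_div, Finset.sum_add_distrib, hx.2, div_self (hD x).ne'])
  have hfx' : ∀ i, d i x = x i * ∑ j, d j x := by
    intro i
    have := congrFun hfx i
    simp only [f] at this
    rw [div_eq_iff (hD x).ne'] at this
    linarith
  refine ⟨x, hx, fun i => ?_⟩
  obtain ⟨j, hj, hjA⟩ := hcov x hx
  have h0 : d j x = 0 := Metric.infDist_zero_of_mem hjA
  have hs : ∑ j, d j x = 0 := by
    have := hfx' j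
    rw [h0] at this
    exact (mul_eq_zero.1 this.symm).resolve_left hj.ne'
  rw [(hA i).mem_iff_infDist_zero (hne i)]
  change d i x = 0
  rw [hfx', hs, mul_zero]

end Simplex

/-! ### Weak topology: compactness, sequential closures, KKM principle. -/

section Weak

variable {E : Type*} [NormedAddCommGroup E] [NormedSpace ℝ E]

theorem continuous_dual_weakSpace (f : StrongDual ℝ E) :
    Continuous fun y : WeakSpace ℝ E => f ((toWeakSpace ℝ E).symm y) :=
  WeakBilin.eval_continuous (topDualPairing ℝ E).flip f

theorem isClosed_toWeakSpace_image {s : Set E} (hs : IsClosed s) (hc : Convex ℝ s) :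
    IsClosed (toWeakSpace ℝ E '' s) := by
  rw [← closure_eq_iff_isClosed, ← hc.toWeakSpace_closure ℝ, hs.closure_eq]

/-- A bounded closed convex subset of a reflexive space is weakly compact. -/
theorem IsReflexive.isCompact_toWeakSpace_image (hE : IsReflexive E) {s : Set E}
    (hb : Bornology.IsBounded s) (hs : IsClosed s) (hc : Convex ℝ s) :
    IsCompact (toWeakSpace ℝ E '' s) := by
  rw [← (isClosed_toWeakSpace_image hs hc).closure_eq]
  refine NormedSpace.isCompact_closure_of_isBounded ℝ E _ ?_ ?_
  · rwa [Set.preimage_image_eq _ (toWeakSpace ℝ E).injective]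
  · rintro f -
    obtain ⟨x, hx⟩ := hE (WeakDual.toStrongDual f)
    exact ⟨toWeakSpace ℝ E x, by
      apply WeakDual.toStrongDual.injective
      rw [← hx]; rfl⟩

/-- Radii of basic weak neighbourhoods are absorbed by rescaling the functionals. With the radius
fixed at 1, a neighbourhood is just a tuple of functionals, to which Banach–Alaoglu applies. -/
theorem mem_closure_toWeakSpace_image_iff {A : Set E} {x : E} :
    toWeakSpace ℝ E x ∈ closure (toWeakSpace ℝ E '' A) ↔
      ∀ (n : ℕ) (f : Fin n → StrongDual ℝ E), ∃ a ∈ A, ∀ i, |f i (a - x)| < 1 := by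
  constructor
  · intro h n f
    have hopen : IsOpen {y : WeakSpace ℝ E | ∀ i, |f i ((toWeakSpace ℝ E).symm y - x)| < 1} := by
      simp only [Set.ofPred_forall]
      refine isOpen_iInter_of_finite fun i => ?_
      simp only [map_sub]
      exact isOpen_lt ((continuous_dual_weakSpace (f i)).sub continuous_const).abs continuous_const
    obtain ⟨_, hy, a, ha, rfl⟩ := mem_closure_iff.1 h _ hopen (by simp)
    exact ⟨a, ha, by simpa using hy⟩
  · intro h
    rw [mem_closure_iff_nhds]
    intro t ht
    have hind : IsInducing fun (y : WeakSpace ℝ E) (f : StrongDual ℝ E) =>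
        f ((toWeakSpace ℝ E).symm y) := ⟨rfl⟩
    rw [hind.nhds_eq_comap, mem_comap, nhds_pi] at ht
    obtain ⟨V, hV, hVt⟩ := ht
    obtain ⟨s, u, hu, hsu⟩ := mem_pi'.1 hV
    choose ε hε hball using fun f => Metric.mem_nhds_iff.1 (hu f)
    obtain ⟨a, ha, hlt⟩ := h s.card fun i => (ε (s.equivFin.symm i))⁻¹ • (s.equivFin.symm i).1
    refine ⟨_, hVt (hsu fun f hf => hball f ?_), a, ha, rfl⟩
    have := hlt (s.equivFin ⟨f, hf⟩)
    simp only [Equiv.symm_apply_apply, _root_.smul_apply, smul_eq_mul, abs_mul,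
      abs_inv, abs_of_pos (hε f)] at this
    rw [inv_mul_lt_iff₀ (hε f), mul_one, map_sub] at this
    simpa [Real.dist_eq] using this

/-- **Kaplansky's theorem**: the weak topology of a normed space is countably tight. -/
theorem exists_countable_mem_closure_toWeakSpace_image {A : Set E} {x : E}
    (hx : toWeakSpace ℝ E x ∈ closure (toWeakSpace ℝ E '' A)) :
    ∃ C ⊆ A, C.Countable ∧ toWeakSpace ℝ E x ∈ closure (toWeakSpace ℝ E '' C) := by
  rw [mem_closure_toWeakSpace_image_iff] at hx
  -- The `n`-tuples of functionals of norm at most `m` form a weak-* compact set, covered by the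
  -- open sets of tuples for which a given `a ∈ A` works. Finitely many `a` suffice.
  have key : ∀ p : ℕ × ℕ, ∃ C ⊆ A, C.Finite ∧ ∀ f : Fin p.1 → StrongDual ℝ E,
      (∀ i, ‖f i‖ ≤ p.2) → ∃ a ∈ C, ∀ i, |f i (a - x)| < 1 := by
    rintro ⟨n, m⟩
    have hcomp : IsCompact (Set.univ.pi fun _ : Fin n =>
        (WeakDual.toStrongDual (𝕜 := ℝ) (E := E)) ⁻¹' Metric.closedBall 0 m) :=
      isCompact_univ_pi fun _ => WeakDual.isCompact_closedBall _ _
    obtain ⟨C, hCA, hCf, hC⟩ := hcomp.elim_finite_subcover_image (b := A)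
      (c := fun a => {f : Fin n → WeakDual ℝ E | ∀ i, |f i (a - x)| < 1})
      (fun a _ => by
        simp only [Set.ofPred_forall]
        refine isOpen_iInter_of_finite fun i => ?_
        exact isOpen_lt ((WeakDual.eval_continuous _).comp (continuous_apply i)).abs
          continuous_const)
      (fun f _ => by
        obtain ⟨a, ha, h⟩ := hx n fun i => WeakDual.toStrongDual (f i)
        exact Set.mem_biUnion ha h)
    refine ⟨C, hCA, hCf, fun f hf => ?_⟩
    have hmem : (fun i => StrongDual.toWeakDual (f i)) ∈ Set.univ.pi fun _ : Fin n =>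
        (WeakDual.toStrongDual (𝕜 := ℝ) (E := E)) ⁻¹' Metric.closedBall 0 m :=
      fun i _ => mem_closedBall_zero_iff.2 (hf i)
    simpa using hC hmem
  choose C hCA hCf hC using key
  refine ⟨⋃ p, C p, Set.iUnion_subset hCA, Set.countable_iUnion fun p => (hCf p).countable, ?_⟩
  rw [mem_closure_toWeakSpace_image_iff]
  intro n f
  obtain ⟨m, hm⟩ := exists_nat_ge (∑ i, ‖f i‖)
  obtain ⟨a, ha, h⟩ := hC (n, m) f fun i =>
    (Finset.single_le_sum (fun j _ => norm_nonneg (f j)) (Finset.mem_univ i)).trans hm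
  exact ⟨a, Set.mem_iUnion.2 ⟨_, ha⟩, h⟩

/-- A separable set is separated from `0` by countably many functionals. -/
theorem exists_dual_seq_separating {M : Set E} (hM : TopologicalSpace.IsSeparable M) :
    ∃ g : ℕ → StrongDual ℝ E, ∀ y ∈ M, (∀ n, g n y = 0) → y = 0 := by
  obtain ⟨c, hc, hMc⟩ := hM
  rcases c.eq_empty_or_nonempty with rfl | hne
  · exact ⟨0, fun y hy => by simpa using hMc hy⟩
  obtain ⟨d, rfl⟩ := hc.exists_eq_range hne
  choose g hg1 hg using fun n => exists_dual_vector'' ℝ (d n)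
  refine ⟨g, fun y hy h0 => ?_⟩
  rw [← norm_le_zero_iff]
  refine le_of_forall_pos_le_add fun ε hε => ?_
  obtain ⟨_, ⟨n, rfl⟩, hn⟩ := Metric.mem_closure_iff.1 (hMc hy) (ε / 2) (half_pos hε)
  rw [dist_eq_norm] at hn
  have h1 : ‖d n‖ ≤ ‖y - d n‖ := by
    have h2 : ‖d n‖ = -(g n (y - d n)) := by
      rw [map_sub, h0, hg]; simp
    rw [h2]
    refine (neg_le_abs _).trans ?_
    simpa using (g n).le_of_opNorm_le (hg1 n) (y - d n)
  have h3 : ‖y‖ ≤ ‖y - d n‖ + ‖d n‖ := by simpa using norm_add_le (y - d n) (d n)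
  linarith

/-- In a reflexive space the weak closure of a bounded set is its weak sequential closure. -/
theorem IsReflexive.exists_seq_weaklyConverges (hE : IsReflexive E) {A : Set E}
    (hA : Bornology.IsBounded A) {x : E}
    (hx : toWeakSpace ℝ E x ∈ closure (toWeakSpace ℝ E '' A)) :
    ∃ u : ℕ → E, (∀ n, u n ∈ A) ∧ WeaklyConverges u x := by
  obtain ⟨C, hCA, hC, hxC⟩ := exists_countable_mem_closure_toWeakSpace_image hx
  obtain ⟨R, hR⟩ := (Metric.isBounded_iff_subset_closedBall (0 : E)).1 hA
  -- By tightness the problem moves into a separable closed subspace. Its bounded part `Q` is weakly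
  -- compact and separated by countably many functionals, hence weakly metrizable, and closure
  -- points are limits of sequences.
  let M : Submodule ℝ E := (Submodule.span ℝ C).topologicalClosure
  have hMsep : TopologicalSpace.IsSeparable (M : Set E) := by
    rw [Submodule.topologicalClosure_coe]
    exact hC.isSeparable.span.closure
  obtain ⟨g, hg⟩ := exists_dual_seq_separating hMsep
  let Q : Set E := M ∩ Metric.closedBall 0 R
  have hQcl : IsClosed Q := (Submodule.isClosed_topologicalClosure _).inter Metric.isClosed_closedBall
  have hQcv : Convex ℝ Q := M.convex.inter (convex_closedBall _ _)
  have hQ := hE.isCompact_toWeakSpace_image (Metric.isBounded_closedBall.subset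
    Set.inter_subset_right) hQcl hQcv
  have hCQ : C ⊆ Q := fun a ha =>
    ⟨Submodule.le_topologicalClosure _ (Submodule.subset_span ha), hR (hCA ha)⟩
  let W : Set (WeakSpace ℝ E) := toWeakSpace ℝ E '' Q
  have hxW : toWeakSpace ℝ E x ∈ W :=
    closure_minimal (Set.image_mono hCQ) (isClosed_toWeakSpace_image hQcl hQcv) hxC
  have : CompactSpace W := isCompact_iff_compactSpace.1 hQ
  have : TopologicalSpace.MetrizableSpace W :=
    Metric.PiNatEmbed.TopologicalSpace.MetrizableSpace.of_countable_separating
      (fun n (w : W) => g n ((toWeakSpace ℝ E).symm w.1))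
      (fun n => (continuous_dual_weakSpace (g n)).comp continuous_subtype_val)
      (by
        rintro ⟨_, y, hy, rfl⟩ ⟨_, z, hz, rfl⟩ hyz
        by_contra hcon
        push Not at hcon
        have h0 : y - z = 0 := hg _ (M.sub_mem hy.1 hz.1) fun n => by
          have := hcon n
          simp only [LinearEquiv.symm_apply_apply] at this
          rw [map_sub, this, sub_self]
        obtain rfl := sub_eq_zero.1 h0
        exact hyz rfl)
  have hcl : (⟨_, hxW⟩ : W) ∈ closure (Subtype.val ⁻¹' (toWeakSpace ℝ E '' C) : Set W) := by
    rw [closure_subtype, Set.image_preimage_eq_of_subset]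
    · exact hxC
    · rw [Subtype.range_coe]
      exact Set.image_mono hCQ
  obtain ⟨w, hw, hlim⟩ := mem_closure_iff_seq_limit.1 hcl
  choose u hu huw using hw
  refine ⟨u, fun n => hCA (hu n), ?_⟩
  have := (continuous_subtype_val.tendsto _).comp hlim
  refine this.congr fun n => (huw n).symm

/-- In a reflexive space a bounded weakly sequentially closed set is weakly closed. -/
theorem IsReflexive.isClosed_toWeakSpace_image_of_seq (hE : IsReflexive E) {A : Set E}
    (hA : Bornology.IsBounded A)
    (h : ∀ (u : ℕ → E) (x : E), (∀ n, u n ∈ A) → WeaklyConverges u x → x ∈ A) :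
    IsClosed (toWeakSpace ℝ E '' A) := by
  refine isClosed_of_closure_subset fun z hz => ?_
  obtain ⟨x, rfl⟩ := (toWeakSpace ℝ E).surjective z
  obtain ⟨u, hu, hux⟩ := hE.exists_seq_weaklyConverges hA hz
  exact ⟨x, h u x hu hux, rfl⟩

theorem WeaklyConverges.of_tendsto {u : ℕ → E} {x : E} (h : Tendsto u atTop (𝓝 x)) :
    WeaklyConverges u x :=
  ((toWeakSpaceCLM ℝ E).continuous.tendsto x).comp h

theorem WeaklyConverges.map {F : Type*} [NormedAddCommGroup F] [NormedSpace ℝ F] (f : E →L[ℝ] F)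
    {u : ℕ → E} {x : E} (h : WeaklyConverges u x) : WeaklyConverges (fun n => f (u n)) (f x) :=
  ((WeakSpace.map f).continuous.tendsto _).comp h

theorem WeaklyConverges.eventually_notMem {s : Set E} (hs : IsClosed s) (hc : Convex ℝ s)
    {u : ℕ → E} {x : E} (h : WeaklyConverges u x) (hx : x ∉ s) : ∀ᶠ n in atTop, u n ∉ s := by
  have := h.eventually ((isClosed_toWeakSpace_image hs hc).isOpen_compl.mem_nhds
    (by simpa using hx))
  filter_upwards [this] with n hn hmem
  exact hn ⟨_, hmem, rfl⟩

/-- A compact operator maps bounded weakly convergent sequences to convergent ones. -/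
theorem WeaklyConverges.tendsto_of_isCompactOperator {F : Type*} [NormedAddCommGroup F]
    [NormedSpace ℝ F] {γ : E →ₗ[ℝ] F} (hγ : IsCompactOperator γ) {u : ℕ → E} {x : E}
    (h : WeaklyConverges u x) (hb : Bornology.IsBounded (Set.range u)) :
    Tendsto (fun n => γ (u n)) atTop (𝓝 (γ x)) := by
  obtain ⟨Q, hQ, hsub⟩ := hγ.image_subset_compact_of_bounded hb
  refine hQ.tendsto_nhds_of_unique_mapClusterPt
    (Eventually.of_forall fun n => hsub ⟨_, ⟨n, rfl⟩, rfl⟩) fun y _ hy => ?_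
  have h1 : WeaklyConverges (fun n => γ (u n)) (γ x) :=
    h.map (⟨γ, hγ.continuous⟩ : E →L[ℝ] F)
  have h2 : MapClusterPt (toWeakSpace ℝ F y) atTop fun n => toWeakSpace ℝ F (γ (u n)) :=
    hy.continuousAt_comp (f := toWeakSpace ℝ F) (toWeakSpaceCLM ℝ F).continuous.continuousAt
  have : toWeakSpace ℝ F y = toWeakSpace ℝ F (γ x) := by
    refine eq_of_nhds_neBot (h2.neBot.mono ?_)
    exact inf_le_inf_left _ h1
  exact (toWeakSpace ℝ F).injective this

/-- An element of the bidual of the product restricts to both factors, and every functional on the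
product is the sum of its two restrictions. -/
theorem IsReflexive.prod {F : Type*} [NormedAddCommGroup F] [NormedSpace ℝ F]
    (hE : IsReflexive E) (hF : IsReflexive F) : IsReflexive (E × F) := by
  intro Φ
  obtain ⟨x, hx⟩ := hE (Φ.comp ((ContinuousLinearMap.compL ℝ (E × F) E ℝ).flip
    (ContinuousLinearMap.fst ℝ E F)))
  obtain ⟨y, hy⟩ := hF (Φ.comp ((ContinuousLinearMap.compL ℝ (E × F) F ℝ).flip
    (ContinuousLinearMap.snd ℝ E F)))
  refine ⟨(x, y), ContinuousLinearMap.ext fun ξ => ?_⟩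
  have h1 := DFunLike.congr_fun hx (ξ.comp (ContinuousLinearMap.inl ℝ E F))
  have h2 := DFunLike.congr_fun hy (ξ.comp (ContinuousLinearMap.inr ℝ E F))
  simp only [NormedSpace.dual_def, ContinuousLinearMap.comp_apply, ContinuousLinearMap.flip_apply,
    ContinuousLinearMap.compL_apply] at h1 h2
  have h3 : ξ = (ξ.comp (ContinuousLinearMap.inl ℝ E F)).comp (ContinuousLinearMap.fst ℝ E F) +
      (ξ.comp (ContinuousLinearMap.inr ℝ E F)).comp (ContinuousLinearMap.snd ℝ E F) := by
    refine ContinuousLinearMap.ext fun p => ?_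
    simp [← map_add]
  rw [NormedSpace.dual_def]
  conv_rhs => rw [h3, map_add, ← h1, ← h2]
  rw [← map_add]
  simp

/-- Fan's form of the KKM principle for weakly sequentially closed subsets of a bounded closed
convex set in a reflexive space. -/
theorem IsReflexive.exists_mem_forall_of_kkm (hE : IsReflexive E) {Q D : Set E}
    (hQb : Bornology.IsBounded Q) (hQ : IsClosed Q) (hQc : Convex ℝ Q) (hD : D.Nonempty)
    {S : E → Set E} (hSQ : ∀ w ∈ D, S w ⊆ Q)
    (hS : ∀ w ∈ D, ∀ (u : ℕ → E) (x : E), (∀ n, u n ∈ S w) → WeaklyConverges u x → x ∈ S w)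
    (hcov : ∀ (t : Finset E), ↑t ⊆ D → ∀ x ∈ stdSimplex ℝ t,
      ∃ i : t, 0 < x i ∧ ∑ j, x j • (j : E) ∈ S i) :
    ∃ z, ∀ w ∈ D, z ∈ S w := by
  classical
  obtain ⟨w₀, hw₀⟩ := hD
  have key := (hE.isCompact_toWeakSpace_image hQb hQ hQc).inter_iInter_nonempty
    (fun w : D => toWeakSpace ℝ E '' S w)
    (fun w => hE.isClosed_toWeakSpace_image_of_seq (hQb.subset (hSQ w w.2)) (hS w w.2)) (by
      intro a
      -- Including `w₀` keeps `t` nonempty and places the point found inside `Q`, even when `a` is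
      -- empty.
      let t : Finset E := insert w₀ (a.image Subtype.val)
      have htD : ↑t ⊆ D := by
        intro w hw
        rcases Finset.mem_insert.1 hw with rfl | hw
        · exact hw₀
        · obtain ⟨w', -, rfl⟩ := Finset.mem_image.1 hw
          exact w'.2
      have : Nonempty t := ⟨⟨w₀, Finset.mem_insert_self _ _⟩⟩
      obtain ⟨x, -, hxA⟩ := exists_mem_forall_of_cover_stdSimplex
        (A := fun i : t => {x | x ∈ stdSimplex ℝ t ∧ ∑ j, x j • (j : E) ∈ S i})
        (fun i => by
          -- In barycentric coordinates convergence is strong, hence weak, so weak sequential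
          -- closedness of `S i` is enough.
          refine IsSeqClosed.isClosed fun y y₀ hy hlim => ?_
          refine ⟨(isClosed_stdSimplex ℝ t).mem_of_tendsto hlim
            (Eventually.of_forall fun n => (hy n).1), ?_⟩
          refine hS i (htD i.2) _ _ (fun n => (hy n).2) (WeaklyConverges.of_tendsto ?_)
          have hc : Continuous fun y : t → ℝ => ∑ j, y j • (j : E) := by fun_prop
          exact (hc.tendsto _).comp hlim)
        (fun x hx => by
          obtain ⟨i, hi, hmem⟩ := hcov t htD x hx
          exact ⟨i, hi, hx, hmem⟩)
      refine ⟨toWeakSpace ℝ E (∑ j, x j • (j : E)), ⟨_, ?_, rfl⟩, Set.mem_iInter₂.2 fun w hw => ?_⟩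
      · exact hSQ w₀ hw₀ (hxA ⟨w₀, Finset.mem_insert_self _ _⟩).2
      · exact ⟨_, (hxA ⟨w, Finset.mem_insert_of_mem (Finset.mem_image_of_mem _ hw)⟩).2, rfl⟩)
  obtain ⟨_, ⟨z, -, rfl⟩, hz⟩ := key
  refine ⟨z, fun w hw => ?_⟩
  obtain ⟨z', hz', heq⟩ := Set.mem_iInter.1 hz ⟨w, hw⟩
  rwa [← (toWeakSpace ℝ E).injective heq]

end Weak

/-! ### Calculus of the generalized directional derivative. -/

section Clarke

set_option linter.unusedSectionVars false

variable {E : Type*} [NormedAddCommGroup E] [NormedSpace ℝ E] {h : E → ℝ}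

/-- The base points and step sizes `(z, t)` with `z → x`, `t ↓ 0`. -/
abbrev clarkeFilter (x : E) : Filter (E × ℝ) := 𝓝 x ×ˢ 𝓝[>] (0 : ℝ)

theorem tendsto_clarkeFilter_nhds (x y : E) :
    Tendsto (fun p : E × ℝ => p.1 + p.2 • y) (clarkeFilter x) (𝓝 x) := by
  have h1 : Tendsto (fun p : E × ℝ => p.1 + p.2 • y) (𝓝 (x, 0)) (𝓝 (x + (0 : ℝ) • y)) :=
    (by fun_prop : Continuous fun p : E × ℝ => p.1 + p.2 • y).tendsto _
  rw [zero_smul, add_zero, nhds_prod_eq] at h1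
  exact h1.mono_left (prod_mono_right _ nhdsWithin_le_nhds)

theorem eventually_clarkeFilter_pos (x : E) : ∀ᶠ p in clarkeFilter x, 0 < p.2 :=
  tendsto_snd.eventually self_mem_nhdsWithin

theorem tendsto_clarkeFilter_scale {a : ℝ} (ha : 0 < a) (x y : E) :
    Tendsto (fun p : E × ℝ => (p.1 + p.2 • y, a * p.2)) (clarkeFilter x) (clarkeFilter x) := by
  refine (tendsto_clarkeFilter_nhds x y).prodMk ?_
  refine tendsto_nhdsWithin_iff.2 ⟨?_, ?_⟩
  · have h1 : Tendsto (fun p : E × ℝ => p.2) (clarkeFilter x) (𝓝 0) :=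
      tendsto_snd.mono_right nhdsWithin_le_nhds
    simpa using h1.const_mul a
  · filter_upwards [eventually_clarkeFilter_pos x] with p hp
    exact mul_pos ha hp

/-- One Lipschitz constant serves all base points `x'` near `x`; this uniformity gives joint upper
semicontinuity. -/
theorem exists_eventually_abs_sub_le (hh : LocallyLipschitz h) (x : E) :
    ∃ C : ℝ, 0 ≤ C ∧ ∀ᶠ x' in 𝓝 x, ∀ y y' : E, ∀ᶠ p in clarkeFilter x',
      |h (p.1 + p.2 • y) - h (p.1 + p.2 • y')| ≤ C * (p.2 * ‖y - y'‖) := by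
  obtain ⟨C, U, hU, hC⟩ := hh x
  refine ⟨C, C.2, ?_⟩
  filter_upwards [eventually_eventually_nhds.2 hU] with x' hx' y y'
  filter_upwards [(tendsto_clarkeFilter_nhds x' y).eventually hx',
    (tendsto_clarkeFilter_nhds x' y').eventually hx', eventually_clarkeFilter_pos x'] with p h1 h2 hp
  have := hC.dist_le_mul _ h1 _ h2
  rwa [Real.dist_eq, dist_eq_norm, add_sub_add_left_eq_sub, ← smul_sub, norm_smul,
    Real.norm_of_nonneg hp.le] at this

theorem exists_eventually_abs_quotient_le (hh : LocallyLipschitz h) (x y : E) :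
    ∃ C, ∀ᶠ p in clarkeFilter x, |(h (p.1 + p.2 • y) - h p.1) / p.2| ≤ C := by
  obtain ⟨C, -, hC⟩ := exists_eventually_abs_sub_le hh x
  refine ⟨C * ‖y‖, ?_⟩
  filter_upwards [hC.self_of_nhds y 0, eventually_clarkeFilter_pos x] with p h1 hp
  rw [abs_div, abs_of_pos hp, div_le_iff₀ hp]
  simpa [mul_assoc, mul_comm, mul_left_comm] using h1

/-- With `clarkeDeriv_le`, this replaces the real `limsup` by eventual bounds on quotients; both
rest on the boundedness of the quotients. -/
theorem eventually_quotient_lt (hh : LocallyLipschitz h) {x y : E} {c : ℝ}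
    (hc : clarkeDeriv h x y < c) :
    ∀ᶠ p in clarkeFilter x, (h (p.1 + p.2 • y) - h p.1) / p.2 < c := by
  obtain ⟨C, hC⟩ := exists_eventually_abs_quotient_le hh x y
  exact eventually_lt_of_limsup_lt hc ⟨C, by
    rw [eventually_map]; filter_upwards [hC] with p hp using (abs_le.1 hp).2⟩

theorem clarkeDeriv_le (hh : LocallyLipschitz h) {x y : E} {c : ℝ}
    (hc : ∀ᶠ p in clarkeFilter x, (h (p.1 + p.2 • y) - h p.1) / p.2 ≤ c) :
    clarkeDeriv h x y ≤ c := by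
  obtain ⟨C, hC⟩ := exists_eventually_abs_quotient_le hh x y
  refine limsup_le_of_le ?_ hc
  have hbdd : IsBoundedUnder (· ≥ ·) (clarkeFilter x)
      fun p => (h (p.1 + p.2 • y) - h p.1) / p.2 := ⟨-C, by
    rw [eventually_map]; filter_upwards [hC] with p hp using (abs_le.1 hp).1⟩
  exact hbdd.isCoboundedUnder_le

theorem clarkeDeriv_zero (h : E → ℝ) (x : E) : clarkeDeriv h x 0 = 0 := by
  simp [clarkeDeriv]

/-- Joint upper semicontinuity of the generalized directional derivative. -/
theorem eventually_clarkeDeriv_lt (hh : LocallyLipschitz h) {x y : E} {c : ℝ}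
    (hc : clarkeDeriv h x y < c) : ∀ᶠ p in 𝓝 x ×ˢ 𝓝 y, clarkeDeriv h p.1 p.2 < c := by
  -- Quotients in direction `y` stay below `c₁`; passing to `y'` costs at most `C * ‖y' - y‖ < c₂ -
  -- c₁`.
  obtain ⟨c₁, hc₁, hc₁c⟩ := exists_between hc
  obtain ⟨c₂, hc₁₂, hc₂c⟩ := exists_between hc₁c
  obtain ⟨C, -, hC⟩ := exists_eventually_abs_sub_le hh x
  obtain ⟨pa, hpa, pb, hpb, hp⟩ := eventually_prod_iff.1 (eventually_quotient_lt hh hc₁)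
  have hy : ∀ᶠ y' in 𝓝 y, C * ‖y' - y‖ < c₂ - c₁ := by
    have h1 : Tendsto (fun y' => C * ‖y' - y‖) (𝓝 y) (𝓝 (C * ‖y - y‖)) :=
      (by fun_prop : Continuous fun y' => C * ‖y' - y‖).tendsto _
    rw [sub_self, norm_zero, mul_zero] at h1
    exact h1.eventually_lt_const (by linarith)
  filter_upwards [prod_mem_prod (inter_mem hC (eventually_eventually_nhds.2 hpa)) hy]
    with ⟨x', y'⟩ ⟨⟨h1, h2⟩, h3⟩
  refine (clarkeDeriv_le hh (c := c₂) ?_).trans_lt hc₂c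
  have h4 : ∀ᶠ p in clarkeFilter x', (h (p.1 + p.2 • y) - h p.1) / p.2 < c₁ :=
    eventually_prod_iff.2 ⟨pa, h2, pb, hpb, hp⟩
  filter_upwards [h4, h1 y' y, eventually_clarkeFilter_pos x'] with p hp1 hp2 hp0
  have h5 : C * ‖y' - y‖ < c₂ - c₁ := h3
  rw [div_lt_iff₀ hp0] at hp1
  rw [div_le_iff₀ hp0]
  have h6 := (abs_le.1 hp2).2
  nlinarith [mul_lt_mul_of_pos_right h5 hp0]

/-- The step along `y + y'` is split at `z + t y'`. This point also tends to `x`, so it is an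
admissible base point for the direction `y`. -/
theorem clarkeDeriv_add_le (hh : LocallyLipschitz h) (x y y' : E) :
    clarkeDeriv h x (y + y') ≤ clarkeDeriv h x y + clarkeDeriv h x y' := by
  refine le_of_forall_pos_le_add fun ε hε => clarkeDeriv_le hh ?_
  have h1 := eventually_quotient_lt hh (lt_add_of_pos_right (clarkeDeriv h x y) (half_pos hε))
  have h2 := eventually_quotient_lt hh (lt_add_of_pos_right (clarkeDeriv h x y') (half_pos hε))
  filter_upwards [(tendsto_clarkeFilter_scale one_pos x y').eventually h1, h2] with p hp1 hp2
  simp only [one_mul] at hp1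
  have h3 : p.1 + p.2 • (y + y') = p.1 + p.2 • y' + p.2 • y := by rw [smul_add]; abel
  have h4 : (h (p.1 + p.2 • (y + y')) - h p.1) / p.2 =
      (h (p.1 + p.2 • y' + p.2 • y) - h (p.1 + p.2 • y')) / p.2 +
        (h (p.1 + p.2 • y') - h p.1) / p.2 := by
    rw [h3, ← add_div]; congr 1; ring
  linarith

theorem clarkeDeriv_smul_le (hh : LocallyLipschitz h) (x y : E) {a : ℝ} (ha : 0 ≤ a) :
    clarkeDeriv h x (a • y) ≤ a * clarkeDeriv h x y := by
  rcases ha.eq_or_lt with rfl | ha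
  · simp [clarkeDeriv_zero]
  refine le_of_forall_pos_le_add fun ε hε => clarkeDeriv_le hh ?_
  have h1 := eventually_quotient_lt hh (lt_add_of_pos_right (clarkeDeriv h x y) (div_pos hε ha))
  filter_upwards [(tendsto_clarkeFilter_scale ha x 0).eventually h1, eventually_clarkeFilter_pos x]
    with p hp hp0
  simp only [smul_zero, add_zero] at hp
  have h2 : (h (p.1 + p.2 • a • y) - h p.1) / p.2 =
      a * ((h (p.1 + (a * p.2) • y) - h p.1) / (a * p.2)) := by
    rw [smul_smul, mul_comm p.2 a]
    field_simp
  rw [h2]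
  have h3 := (mul_lt_mul_of_pos_left hp ha).le
  rwa [mul_add, mul_div_cancel₀ _ ha.ne'] at h3

theorem convexOn_clarkeDeriv (hh : LocallyLipschitz h) (x : E) :
    ConvexOn ℝ Set.univ (clarkeDeriv h x) :=
  ⟨convex_univ, fun y _ y' _ _ _ ha hb _ => (clarkeDeriv_add_le hh x _ _).trans
    (add_le_add (clarkeDeriv_smul_le hh x y ha) (clarkeDeriv_smul_le hh x y' hb))⟩

end Clarke

/-! ### Weak semicontinuity of the individual terms. -/

section Functionals

variable {E : Type*} [NormedAddCommGroup E] [NormedSpace ℝ E]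

theorem IsProper.coe_toReal {α : Type*} {φ : α → EReal} (hφ : IsProper φ) {x : α}
    (hx : x ∈ effectiveDomain φ) : ((φ x).toReal : EReal) = φ x :=
  EReal.coe_toReal (ne_of_lt hx) (hφ.1 x)

/-- A convex functional is a convex real function on its effective domain. -/
theorem IsConvexFunctional.convexOn_toReal {φ : E → EReal} (hφ : IsProper φ)
    (hc : IsConvexFunctional φ) : ConvexOn ℝ (effectiveDomain φ) fun x => (φ x).toReal := by
  have key : ∀ x ∈ effectiveDomain φ, ∀ y ∈ effectiveDomain φ, ∀ a b : ℝ, 0 ≤ a → 0 ≤ b →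
      a + b = 1 → φ (a • x + b • y) ≤ ((a * (φ x).toReal + b * (φ y).toReal : ℝ) : EReal) := by
    intro x hx y hy a b ha hb hab
    obtain rfl : b = 1 - a := by linarith
    have := hc x y a ha (by linarith)
    rw [← hφ.coe_toReal hx, ← hφ.coe_toReal hy] at this
    exact_mod_cast this
  refine ⟨fun x hx y hy a b ha hb hab => ?_, fun x hx y hy a b ha hb hab => ?_⟩
  · exact (key x hx y hy a b ha hb hab).trans_lt (EReal.coe_lt_top _)
  · have h1 := key x hx y hy a b ha hb hab
    rw [← hφ.coe_toReal (h1.trans_lt (EReal.coe_lt_top _)), EReal.coe_le_coe_iff] at h1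
    exact h1

/-- Weak sequential lower semicontinuity of a convex lower semicontinuous functional. -/
theorem WeaklyConverges.eventually_lt_functional {φ : E → EReal} (hφ : IsProper φ)
    (hc : IsConvexFunctional φ) (hlsc : LowerSemicontinuous φ) {u : ℕ → E} {x : E}
    (h : WeaklyConverges u x) {c : ℝ} (hcx : (c : EReal) < φ x) :
    ∀ᶠ n in atTop, (c : EReal) < φ (u n) := by
  have heq : {x ∈ effectiveDomain φ | (φ x).toReal ≤ c} = {x | φ x ≤ c} := by
    ext y
    constructor
    · rintro ⟨hy, hyc⟩
      change φ y ≤ c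
      rw [← hφ.coe_toReal hy]
      exact_mod_cast hyc
    · intro hy
      have hyD : y ∈ effectiveDomain φ := lt_of_le_of_lt hy (EReal.coe_lt_top _)
      change φ y ≤ c at hy
      rw [← hφ.coe_toReal hyD] at hy
      exact ⟨hyD, by exact_mod_cast hy⟩
  have hconv : Convex ℝ {x | φ x ≤ c} := heq ▸ (hc.convexOn_toReal hφ).convex_le c
  filter_upwards [h.eventually_notMem (hlsc.isClosed_preimage c) hconv (not_le.2 hcx)] with n hn
  exact not_le.1 hn

/-- Weak sequential lower semicontinuity of a convex lower semicontinuous real function. -/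
theorem WeaklyConverges.eventually_lt_of_convexOn {f : E → ℝ} (hc : ConvexOn ℝ Set.univ f)
    (hlsc : LowerSemicontinuous f) {u : ℕ → E} {x : E} (h : WeaklyConverges u x) {c : ℝ}
    (hcx : c < f x) : ∀ᶠ n in atTop, c < f (u n) := by
  have hconv : Convex ℝ {x | f x ≤ c} := by simpa using hc.convex_le c
  filter_upwards [h.eventually_notMem (hlsc.isClosed_preimage c) hconv (not_le.2 hcx)] with n hn
  exact not_le.1 hn

theorem IsWeaklyLscPairing.eventually_lt {A : E → StrongDual ℝ E} (hA : IsWeaklyLscPairing A)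
    {u : ℕ → E} {x : E} (h : WeaklyConverges u x) (v : E) {c : ℝ} (hc : c < A x (v - x)) :
    ∀ᶠ n in atTop, c < A (u n) (v - u n) := by
  have := eventually_lt_of_lt_liminf ((EReal.coe_lt_coe_iff.2 hc).trans_le (hA v u x h))
  filter_upwards [this] with n hn
  exact_mod_cast hn

/-- Weak-to-strong upper semicontinuity of the generalized directional derivative along a compact
operator. -/
theorem WeaklyConverges.eventually_clarkeDeriv_lt {Z : Type*} [NormedAddCommGroup Z]
    [NormedSpace ℝ Z] {h : Z → ℝ} (hh : LocallyLipschitz h) {γ : E →ₗ[ℝ] Z}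
    (hγ : IsCompactOperator γ) {u : ℕ → E} {x : E} (hu : WeaklyConverges u x)
    (hb : Bornology.IsBounded (Set.range u)) (v : E) {c : ℝ}
    (hc : clarkeDeriv h (γ x) (γ (v - x)) < c) :
    ∀ᶠ n in atTop, clarkeDeriv h (γ (u n)) (γ (v - u n)) < c := by
  have h1 := hu.tendsto_of_isCompactOperator hγ hb
  have h2 : Tendsto (fun n => γ (v - u n)) atTop (𝓝 (γ (v - x))) := by
    simp only [map_sub]
    exact h1.const_sub _
  exact (h1.prodMk h2).eventually (CoupledSystem.eventually_clarkeDeriv_lt hh hc)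

/-- Only upper bounds on `b` are available, so positivity of the factor is essential. This is where
`0 < H` enters the closedness argument. -/
theorem eventually_mul_lt_of_tendsto {a : ℕ → ℝ} {a₀ b₀ : ℝ} {b : ℕ → ℝ} (ha₀ : 0 < a₀)
    (ha : Tendsto a atTop (𝓝 a₀)) (hb : ∀ c, b₀ < c → ∀ᶠ n in atTop, b n < c) {c : ℝ}
    (hc : a₀ * b₀ < c) : ∀ᶠ n in atTop, a n * b n < c := by
  obtain ⟨d, hbd, hdc⟩ := exists_between ((lt_div_iff₀' ha₀).2 hc)
  filter_upwards [hb d hbd, ha.eventually_const_lt ha₀,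
    (ha.mul_const d).eventually_lt_const ((lt_div_iff₀' ha₀).1 hdc)] with n h1 h2 h3
  exact (mul_lt_mul_of_pos_left h1 h2).trans h3

theorem convexOn_comp_linear_sub {W Z : Type*} [AddCommGroup W] [Module ℝ W] [AddCommGroup Z]
    [Module ℝ Z] {f : Z → ℝ} (hf : ConvexOn ℝ Set.univ f) (g : W →ₗ[ℝ] Z) (z : Z) {s : Set W}
    (hs : Convex ℝ s) : ConvexOn ℝ s fun w => f (g w - z) := by
  refine ⟨hs, fun w _ w' _ a b ha hb hab => ?_⟩
  have : g (a • w + b • w') - z = a • (g w - z) + b • (g w' - z) := by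
    have hz : z = a • z + b • z := by rw [← add_smul, hab, one_smul]
    rw [map_add, map_smul, map_smul, smul_sub, smul_sub]
    nth_rewrite 1 [hz]
    abel
  dsimp only
  rw [this]
  exact hf.2 (Set.mem_univ _) (Set.mem_univ _) ha hb hab

end Functionals

/-! ### The joint inequality and the system. -/

section System

variable {X Y Z₁ Z₂ : Type*}
    [NormedAddCommGroup X] [NormedSpace ℝ X] [NormedAddCommGroup Y] [NormedSpace ℝ Y]
    [NormedAddCommGroup Z₁] [NormedSpace ℝ Z₁] [NormedAddCommGroup Z₂] [NormedSpace ℝ Z₂]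

/-- The sum of the two inequalities of the system, with the joint increment of `B`, solved for
`φ u`. -/
noncomputable def jointBound (B : X × Y → ℝ) (φ : X → EReal) (J : Z₁ → ℝ) (L : Z₂ → ℝ)
    (H : Y → ℝ) (γ₁ : X →ₗ[ℝ] Z₁) (γ₂ : Y →ₗ[ℝ] Z₂)
    (F : X → StrongDual ℝ X) (G : Y → StrongDual ℝ Y) (z w : X × Y) : ℝ :=
  B w - B z + (φ w.1).toReal + clarkeDeriv J (γ₁ z.1) (γ₁ (w.1 - z.1))
    + H z.2 * clarkeDeriv L (γ₂ z.2) (γ₂ (w.2 - z.2)) - F z.1 (w.1 - z.1) - G z.2 (w.2 - z.2)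

variable {B : X × Y → ℝ} {φ : X → EReal} {J : Z₁ → ℝ} {L : Z₂ → ℝ} {H : Y → ℝ}
  {γ₁ : X →ₗ[ℝ] Z₁} {γ₂ : Y →ₗ[ℝ] Z₂} {F : X → StrongDual ℝ X} {G : Y → StrongDual ℝ Y}

theorem convexOn_jointBound (hφ : IsProper φ) (hφc : IsConvexFunctional φ)
    (hJ : LocallyLipschitz J) (hL : LocallyLipschitz L) (hH : ∀ σ, 0 < H σ)
    (hB : ConvexOn ℝ Set.univ B) (z : X × Y) :
    ConvexOn ℝ (effectiveDomain φ ×ˢ Set.univ) (jointBound B φ J L H γ₁ γ₂ F G z) := by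
  have hφr := hφc.convexOn_toReal hφ
  have hs : Convex ℝ (effectiveDomain φ ×ˢ (Set.univ : Set Y)) := hφr.1.prod convex_univ
  have h1 : ConvexOn ℝ (effectiveDomain φ ×ˢ (Set.univ : Set Y)) fun w => (φ w.1).toReal :=
    ⟨hs, fun w hw w' hw' _ _ ha hb hab => hφr.2 hw.1 hw'.1 ha hb hab⟩
  have h2 : ConvexOn ℝ (effectiveDomain φ ×ˢ (Set.univ : Set Y)) fun w =>
      clarkeDeriv J (γ₁ z.1) (γ₁ (w.1 - z.1)) := by
    simp only [map_sub]
    exact convexOn_comp_linear_sub (convexOn_clarkeDeriv hJ (γ₁ z.1))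
      (γ₁ ∘ₗ LinearMap.fst ℝ X Y) (γ₁ z.1) hs
  have h3 : ConvexOn ℝ (effectiveDomain φ ×ˢ (Set.univ : Set Y)) fun w =>
      H z.2 * clarkeDeriv L (γ₂ z.2) (γ₂ (w.2 - z.2)) := by
    simp only [map_sub]
    exact (convexOn_comp_linear_sub (convexOn_clarkeDeriv hL (γ₂ z.2))
      (γ₂ ∘ₗ LinearMap.snd ℝ X Y) (γ₂ z.2) hs).smul (hH z.2).le
  have h4 : ConvexOn ℝ (effectiveDomain φ ×ˢ (Set.univ : Set Y)) fun w =>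
      (-F z.1) (w.1 - z.1) :=
    convexOn_comp_linear_sub ((-F z.1 : StrongDual ℝ X).toLinearMap.convexOn convex_univ)
      (LinearMap.fst ℝ X Y) z.1 hs
  have h5 : ConvexOn ℝ (effectiveDomain φ ×ˢ (Set.univ : Set Y)) fun w =>
      (-G z.2) (w.2 - z.2) :=
    convexOn_comp_linear_sub ((-G z.2 : StrongDual ℝ Y).toLinearMap.convexOn convex_univ)
      (LinearMap.snd ℝ X Y) z.2 hs
  have h6 := (hB.subset (Set.subset_univ _) hs).add (convexOn_const (-B z) hs)
  refine (((((h6.add h1).add h2).add h3).add h4).add h5).congr fun w _ => ?_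
  simp only [Pi.add_apply, neg_apply, jointBound]
  ring

theorem jointBound_self (z : X × Y) : jointBound B φ J L H γ₁ γ₂ F G z z = (φ z.1).toReal := by
  simp [jointBound, clarkeDeriv_zero]

/-- The set of `z` for which the joint inequality tested with `w` holds is weakly sequentially
closed. -/
theorem le_jointBound_of_weaklyConverges (hφ : IsProper φ) (hφc : IsConvexFunctional φ)
    (hφl : LowerSemicontinuous φ) (hJ : LocallyLipschitz J) (hL : LocallyLipschitz L)
    (hγ₁ : IsCompactOperator γ₁) (hγ₂ : IsCompactOperator γ₂) (hH : ∀ σ, 0 < H σ)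
    (hHc : IsWeaklyContinuous H) (hB : ConvexOn ℝ Set.univ B) (hBl : LowerSemicontinuous B)
    (hF : IsWeaklyLscPairing F) (hG : IsWeaklyLscPairing G) (w : X × Y) {u : ℕ → X × Y}
    {z : X × Y} (hu : WeaklyConverges u z) (hb : Bornology.IsBounded (Set.range u))
    (hle : ∀ n, φ (u n).1 ≤ (jointBound B φ J L H γ₁ γ₂ F G (u n) w : ℝ)) :
    φ z.1 ≤ (jointBound B φ J L H γ₁ γ₂ F G z w : ℝ) := by
  by_contra hcon
  obtain ⟨c, hRc, hcφ⟩ := EReal.lt_iff_exists_real_btwn.1 (not_le.1 hcon)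
  rw [EReal.coe_lt_coe_iff] at hRc
  -- One `ε` for each of the five terms of the bound that depend on `z`: `B`, the two Clarke terms,
  -- `F` and `G`.
  obtain ⟨ε, hε, hεc⟩ : ∃ ε, 0 < ε ∧ jointBound B φ J L H γ₁ γ₂ F G z w + 5 * ε = c :=
    ⟨(c - jointBound B φ J L H γ₁ γ₂ F G z w) / 5, by linarith, by ring⟩
  have hu₁ : WeaklyConverges (fun n => (u n).1) z.1 := hu.map (ContinuousLinearMap.fst ℝ X Y)
  have hu₂ : WeaklyConverges (fun n => (u n).2) z.2 := hu.map (ContinuousLinearMap.snd ℝ X Y)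
  have hb₁ : Bornology.IsBounded (Set.range fun n => (u n).1) := by
    rw [Set.range_comp' Prod.fst u]; exact hb.image_fst
  have hb₂ : Bornology.IsBounded (Set.range fun n => (u n).2) := by
    rw [Set.range_comp' Prod.snd u]; exact hb.image_snd
  have hHn : Tendsto (fun n => H (u n).2) atTop (𝓝 (H z.2)) :=
    (hHc.tendsto (toWeakSpace ℝ Y z.2)).comp hu₂
  have e1 := hu₁.eventually_lt_functional hφ hφc hφl hcφ
  have e2 := hu.eventually_lt_of_convexOn hB hBl (sub_lt_self (B z) hε)
  have e3 := hu₁.eventually_clarkeDeriv_lt hJ hγ₁ hb₁ w.1 (lt_add_of_pos_right _ hε)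
  have e4 := eventually_mul_lt_of_tendsto (hH z.2) hHn
    (fun c hc => hu₂.eventually_clarkeDeriv_lt hL hγ₂ hb₂ w.2 hc) (lt_add_of_pos_right _ hε)
  have e5 := hF.eventually_lt hu₁ w.1 (sub_lt_self _ hε)
  have e6 := hG.eventually_lt hu₂ w.2 (sub_lt_self _ hε)
  obtain ⟨n, h1, h2, h3, h4, h5, h6⟩ :=
    (e1.and (e2.and (e3.and (e4.and (e5.and e6))))).exists
  have h7 := h1.trans_le (hle n)
  rw [EReal.coe_lt_coe_iff] at h7
  simp only [jointBound] at h7 hεc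
  linarith

/-- Among finitely many test points, the joint inequality holds at a convex combination for one of
those of positive weight. -/
theorem exists_le_jointBound_of_convexCombination (hφ : IsProper φ)
    (hφc : IsConvexFunctional φ) (hJ : LocallyLipschitz J) (hL : LocallyLipschitz L)
    (hH : ∀ σ, 0 < H σ) (hB : ConvexOn ℝ Set.univ B) {t : Finset (X × Y)}
    (ht : ∀ w ∈ t, w.1 ∈ effectiveDomain φ) {x : t → ℝ} (hx : x ∈ stdSimplex ℝ t) :
    ∃ i : t, 0 < x i ∧ φ (∑ j, x j • (j : X × Y)).1 ≤
      (jointBound B φ J L H γ₁ γ₂ F G (∑ j, x j • (j : X × Y)) i : ℝ) := by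
  set z : X × Y := ∑ j, x j • (j : X × Y) with hz
  have hconv := convexOn_jointBound (γ₁ := γ₁) (γ₂ := γ₂) (F := F) (G := G) hφ hφc hJ hL hH hB z
  have hmem : ∀ j : t, (j : X × Y) ∈ effectiveDomain φ ×ˢ (Set.univ : Set Y) :=
    fun j => ⟨ht j j.2, trivial⟩
  have hzD : z.1 ∈ effectiveDomain φ :=
    (hconv.1.sum_mem (fun j _ => hx.1 j) hx.2 fun j _ => hmem j).1
  -- Jensen at `z` bounds φ(z.1), the value of the bound at `w = z`, by the weighted mean of its
  -- values at the test points. Not all those of positive weight can lie below φ(z.1).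
  have hjensen := hconv.map_sum_le (t := Finset.univ) (fun j _ => hx.1 j) hx.2 fun j _ => hmem j
  rw [← hz, jointBound_self] at hjensen
  by_contra hcon
  push Not at hcon
  have hlt : ∀ i, 0 < x i → jointBound B φ J L H γ₁ γ₂ F G z i < (φ z.1).toReal := by
    intro i hi
    have := hcon i hi
    rw [← hφ.coe_toReal hzD] at this
    exact_mod_cast this
  obtain ⟨i₀, hi₀⟩ : ∃ i, 0 < x i := by
    by_contra hneg
    push Not at hneg
    have := Finset.sum_nonpos fun i (_ : i ∈ Finset.univ) => hneg i
    rw [hx.2] at this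
    exact absurd this (by norm_num)
  have : ∑ i, x i • jointBound B φ J L H γ₁ γ₂ F G z i < ∑ i, x i • (φ z.1).toReal := by
    refine Finset.sum_lt_sum (fun i _ => ?_) ⟨i₀, Finset.mem_univ _, ?_⟩
    · rcases (hx.1 i).eq_or_lt with h | h
      · rw [← h, zero_smul, zero_smul]
      · exact (mul_lt_mul_of_pos_left (hlt i h) h).le
    · exact mul_lt_mul_of_pos_left (hlt i₀ hi₀) hi₀
  rw [← Finset.sum_smul, hx.2, one_smul] at this
  exact absurd hjensen (not_le.2 this)

/-- A solution of the joint inequality solves the system. -/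
theorem isSolution_of_le_jointBound {K : Set X} {Λ : Set Y} (hφ : IsProper φ) {z : X × Y}
    (hzK : z.1 ∈ K) (hzD : z.1 ∈ effectiveDomain φ) (hzΛ : z.2 ∈ Λ)
    (h : ∀ w ∈ (K ∩ effectiveDomain φ) ×ˢ Λ,
      φ z.1 ≤ (jointBound B φ J L H γ₁ γ₂ F G z w : ℝ)) :
    IsSolution K Λ B φ J L H γ₁ γ₂ F G z.1 z.2 := by
  have h' : ∀ w ∈ (K ∩ effectiveDomain φ) ×ˢ Λ,
      (φ z.1).toReal ≤ jointBound B φ J L H γ₁ γ₂ F G z w := by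
    intro w hw
    have := h w hw
    rw [← hφ.coe_toReal hzD] at this
    exact_mod_cast this
  refine ⟨hzK, hzD, hzΛ, fun v hv => ?_, fun μ hμ => ?_⟩
  · rw [← hφ.coe_toReal hzD]
    by_cases hvD : v ∈ effectiveDomain φ
    · have h1 := h' (v, z.2) ⟨⟨hv, hvD⟩, hzΛ⟩
      simp only [jointBound, sub_self, map_zero, clarkeDeriv_zero, mul_zero, add_zero,
        sub_zero] at h1
      rw [← hφ.coe_toReal hvD, ge_iff_le]
      norm_cast
      linarith
    -- Outside the effective domain the left side is `⊤`, so restricting the test points to D(φ)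
    -- loses nothing.
    · have hv' : φ v = ⊤ := not_lt_top_iff.1 hvD
      rw [hv', EReal.top_sub_coe, EReal.coe_add_top, EReal.top_add_coe]
      exact le_top
  · have h1 := h' (z.1, μ) ⟨⟨hzK, hzD⟩, hμ⟩
    simp only [jointBound, sub_self, map_zero, clarkeDeriv_zero, add_zero, sub_zero] at h1
    change _ ≤ _
    linarith

end System

end CoupledSystem

theorem mainTheorem1 {X Y Z₁ Z₂ : Type*}
    [NormedAddCommGroup X] [NormedSpace ℝ X] [CompleteSpace X]
    [NormedAddCommGroup Y] [NormedSpace ℝ Y] [CompleteSpace Y]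
    [NormedAddCommGroup Z₁] [NormedSpace ℝ Z₁] [CompleteSpace Z₁]
    [NormedAddCommGroup Z₂] [NormedSpace ℝ Z₂] [CompleteSpace Z₂]
    (hX : CoupledSystem.IsReflexive X) (hY : CoupledSystem.IsReflexive Y)
    (K : Set X) (hK_ne : K.Nonempty) (hK_bdd : Bornology.IsBounded K)
    (hK_closed : IsClosed K) (hK_conv : Convex ℝ K)
    (Λ : Set Y) (hΛ_ne : Λ.Nonempty) (hΛ_bdd : Bornology.IsBounded Λ)
    (hΛ_closed : IsClosed Λ) (hΛ_conv : Convex ℝ Λ)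
    (φ : X → EReal) (hφ_proper : CoupledSystem.IsProper φ)
    (hφ_conv : CoupledSystem.IsConvexFunctional φ) (hφ_lsc : LowerSemicontinuous φ)
    (hφK : (CoupledSystem.effectiveDomain φ ∩ K).Nonempty)
    (J : Z₁ → ℝ) (hJ : LocallyLipschitz J)
    (L : Z₂ → ℝ) (hL : LocallyLipschitz L)
    (γ₁ : X →ₗ[ℝ] Z₁) (hγ₁ : IsCompactOperator γ₁)
    (γ₂ : Y →ₗ[ℝ] Z₂) (hγ₂ : IsCompactOperator γ₂)
    (H : Y → ℝ) (mH : ℝ) (hH_range : ∀ σ, H σ ∈ Set.Ioo 0 mH)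
    (hH_cont : CoupledSystem.IsWeaklyContinuous H)
    (B : X × Y → ℝ) (hB_conv : ConvexOn ℝ Set.univ B) (hB_lsc : LowerSemicontinuous B)
    (F : X → StrongDual ℝ X) (hF : CoupledSystem.IsWeaklyLscPairing F)
    (G : Y → StrongDual ℝ Y) (hG : CoupledSystem.IsWeaklyLscPairing G) :
    ∃ (u : X) (σ : Y), CoupledSystem.IsSolution K Λ B φ J L H γ₁ γ₂ F G u σ := by
  have hH : ∀ σ, 0 < H σ := fun σ => (hH_range σ).1
  have hQ : IsClosed (K ×ˢ Λ) := hK_closed.prod hΛ_closed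
  have hQc : Convex ℝ (K ×ˢ Λ) := hK_conv.prod hΛ_conv
  have hQb : Bornology.IsBounded (K ×ˢ Λ) := hK_bdd.prod hΛ_bdd
  obtain ⟨v₀, hv₀D, hv₀K⟩ := hφK
  obtain ⟨μ₀, hμ₀⟩ := hΛ_ne
  have hw₀ : (v₀, μ₀) ∈ (K ∩ CoupledSystem.effectiveDomain φ) ×ˢ Λ := ⟨⟨hv₀K, hv₀D⟩, hμ₀⟩
  obtain ⟨z, hz⟩ := (hX.prod hY).exists_mem_forall_of_kkm
    (D := (K ∩ CoupledSystem.effectiveDomain φ) ×ˢ Λ) hQb hQ hQc ⟨_, hw₀⟩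
    (S := fun w => {z | z ∈ K ×ˢ Λ ∧
      φ z.1 ≤ (CoupledSystem.jointBound B φ J L H γ₁ γ₂ F G z w : ℝ)})
    (fun w _ z hz => hz.1)
    (by
      intro w _ u z hu huz
      refine ⟨?_, ?_⟩
      · by_contra hcon
        obtain ⟨n, hn⟩ := (huz.eventually_notMem hQ hQc hcon).exists
        exact hn (hu n).1
      · exact CoupledSystem.le_jointBound_of_weaklyConverges hφ_proper hφ_conv hφ_lsc hJ hL hγ₁ hγ₂
          hH hH_cont hB_conv hB_lsc hF hG w huz
          (hQb.subset (Set.range_subset_iff.2 fun n => (hu n).1)) fun n => (hu n).2)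
    (by
      intro t ht x hx
      obtain ⟨i, hi, hle⟩ := CoupledSystem.exists_le_jointBound_of_convexCombination
        (γ₁ := γ₁) (γ₂ := γ₂) (F := F) (G := G) hφ_proper hφ_conv hJ hL hH hB_conv
        (fun w hw => (ht hw).1.2) hx
      refine ⟨i, hi, hQc.sum_mem (fun j _ => hx.1 j) hx.2 fun j _ => ?_, hle⟩
      exact ⟨(ht j.2).1.1, (ht j.2).2⟩)
  -- A single admissible test point already gives `z ∈ K ×ˢ Λ`, and φ(z.1) < ∞ because the bound is
  -- a real number.
  have hzw := hz _ hw₀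
  exact ⟨z.1, z.2, CoupledSystem.isSolution_of_le_jointBound hφ_proper hzw.1.1
    (hzw.2.trans_lt (EReal.coe_lt_top _)) hzw.1.2 fun w hw => (hz w hw).2⟩
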